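/- Let $d\ge 1$ and $k\ge 2$ be integers, let $\Sigma_k=\{0,\dots,k-1\}$ with the discrete topology, and let $\mathbb Z^d$ act on $(\Sigma_k)^{\mathbb Z^d}$ (product topology) by $(gx)(h)=x(h+g)$. For every real $h$ with $0<h<\log k$ there is an array $x\in(\Sigma_k)^{\mathbb Z^d}$ with the following properties, where $X$ denotes the closure of the orbit $\{gx : g\in\mathbb Z^d\}$ with the restricted action. (1) $x$ is a Toeplitz array: for every $g\in\mathbb Z^d$ there is a finite index subgroup $\Gamma\le\mathbb Z^d$ with $x(g+\gamma)=x(g)$ for all $\gamma\in\Gamma$. (2) $X$ is strictly ergodic: every orbit in $X$ is dense in $X$, and $X$ carries exactly one invariant Borel probability measure. (3) $X$ has topological entropy $h$: for every Følner sequence $(F_n)$ of $\mathbb Z^d$, the limit $\lim_{n\to\infty}\frac{\log\theta_{F_n}(X)}{\#F_n}$ exists and equals $h$, where $\theta_F(X)$ is the number of blocks $B\in(\Sigma_k)^{F}$ that are the restriction to $F$ of some element of $X$. (4) The maximal equicontinuous factor of $X$ is the universal $\mathbb Z^d$-odometer. Here the odometer of a decreasing sequence $(\Gamma_n)$ of finite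 index subgroups of $\mathbb Z^d$ is the inverse limit $\varprojlim_n\mathbb Z^d/\Gamma_n$ with the coordinatewise translation action of $\mathbb Z^d$, and it is universal if every $\mathbb Z^d$-odometer is a factor of it (a factor being an image under a continuous equivariant surjection). That is, there are a universal $\mathbb Z^d$-odometer $Y$ and a factor map $\pi:X\to Y$ such that $Y$ is equicontinuous and every factor map from $X$ onto an equicontinuous compact Hausdorff $\mathbb Z^d$-system $Z$ is of the form $\psi\circ\pi$ for some factor map $\psi:Y\to Z$. -/

import Mathlib

open MeasureTheory Filter Topology
open SymbolicDynamics.FullShift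

/-! ### Topological dynamical systems of a discrete abelian group -/

section Systems

/-- `f` is a factor map of `G`-systems: continuous, surjective and `G`-equivariant. -/
structure IsFactorMap (G : Type*) {X Y : Type*} [AddCommGroup G]
    [TopologicalSpace X] [AddAction G X] [TopologicalSpace Y] [AddAction G Y]
    (f : X → Y) : Prop where
  continuous : Continuous f
  surjective : Function.Surjective f
  map_vadd : ∀ (g : G) (x : X), f (g +ᵥ x) = g +ᵥ f x

/-- The action of `G` on `X` has exactly one invariant Borel probability measure. -/
def IsUniquelyErgodic (G X : Type*) [AddCommGroup G] [AddAction G X]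
    [TopologicalSpace X] [MeasurableSpace X] [BorelSpace X] : Prop :=
  ∃! μ : Measure X, IsProbabilityMeasure μ ∧ VAddInvariantMeasure G X μ

/-- Minimal (every orbit is dense) and uniquely ergodic. -/
def IsStrictlyErgodic (G X : Type*) [AddCommGroup G] [AddAction G X]
    [TopologicalSpace X] [MeasurableSpace X] [BorelSpace X] : Prop :=
  AddAction.IsMinimal G X ∧ IsUniquelyErgodic G X

/-- The translations `x ↦ g +ᵥ x`, `g : G`, of the compact Hausdorff space `X` form a uniformly
equicontinuous family for the unique uniform structure inducing the topology of `X`. -/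
def IsEquicontinuousSystem (G X : Type*) [AddCommGroup G] [AddAction G X]
    [TopologicalSpace X] [CompactSpace X] [T2Space X] [ContinuousConstVAdd G X] : Prop :=
  letI : UniformSpace X := uniformSpaceOfCompactR1
  UniformEquicontinuous (fun (g : G) (x : X) => g +ᵥ x)

/-- `Y` is the maximal equicontinuous factor of `X`: it is an equicontinuous factor of `X`, by a
factor map `π` through which every factor map of `X` onto an equicontinuous system factors.
(Every factor of `X` is a quotient of `X` up to conjugacy, so that it is enough to let `Z` range
over the universe of `X`.) -/
def IsMaximalEquicontinuousFactor.{u, v, w} (G : Type w) (X : Type u) (Y : Type v)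
    [AddCommGroup G]
    [TopologicalSpace X] [CompactSpace X] [T2Space X] [AddAction G X] [ContinuousConstVAdd G X]
    [TopologicalSpace Y] [CompactSpace Y] [T2Space Y] [AddAction G Y] [ContinuousConstVAdd G Y] :
    Prop :=
  IsEquicontinuousSystem G Y ∧
    ∃ π : X → Y, IsFactorMap G π ∧
      ∀ (Z : Type u) [TopologicalSpace Z] [CompactSpace Z] [T2Space Z] [AddAction G Z]
        [ContinuousConstVAdd G Z], IsEquicontinuousSystem G Z →
        ∀ f : X → Z, IsFactorMap G f → ∃ ψ : Y → Z, IsFactorMap G ψ ∧ ψ ∘ π = f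

end Systems

/-! ### Subshifts -/

section Subshifts

/-- `x` is a Toeplitz array: for every `g` there is a finite index subgroup `Γ` such that `x` is
constant on the coset `g + Γ`. -/
def IsToeplitz {A G : Type*} [AddCommGroup G] (x : G → A) : Prop :=
  ∀ g : G, ∃ Γ : AddSubgroup G, Γ.FiniteIndex ∧ ∀ γ ∈ Γ, x (g + γ) = x g

variable {A G : Type*} [TopologicalSpace A] [AddCommGroup G]

/-- The shift action of `G` on the points of a subshift: `(g +ᵥ y) h = y (g + h)`. -/
instance Subshift.instAddAction (Y : Subshift A G) : AddAction G Y.carrier where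
  vadd g y := ⟨shift g y.1, Y.mapsTo g y.2⟩
  zero_vadd y := Subtype.ext (shift_zero y.1)
  add_vadd g h y := Subtype.ext (by
    change shift (g + h) y.1 = shift g (shift h y.1)
    rw [add_comm, shift_add])

instance Subshift.instContinuousConstVAdd (Y : Subshift A G) :
    ContinuousConstVAdd G Y.carrier where
  continuous_const_vadd g :=
    ((continuous_shift g).comp continuous_subtype_val).subtype_mk _

instance Subshift.instCompactSpace [CompactSpace A] (Y : Subshift A G) :
    CompactSpace Y.carrier :=
  isCompact_iff_compactSpace.mp Y.isClosed.isCompact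

/-- The subshift generated by `x`: the closure of the orbit of `x` under the shift action. -/
def orbitClosure (x : G → A) : Subshift A G where
  carrier := closure (Set.range fun g : G => shift g x)
  isClosed := isClosed_closure
  mapsTo g := by
    refine Set.MapsTo.closure ?_ (continuous_shift g)
    rintro _ ⟨h, rfl⟩
    exact ⟨h + g, shift_add h g x⟩

/-- The number of blocks `B : M → A` that occur in the subshift `Y`. -/
noncomputable def blockCount (Y : Subshift A G) (M : Finset G) : ℕ :=
  Set.ncard {B : M → A | ∃ y ∈ Y.carrier, ∀ m : M, y m = B m}

/-- The subshift `Y` has topological entropy `h`: for every Følner sequence `(F n)` of `G`, the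
limit of `log (blockCount Y (F n)) / #(F n)` exists and equals `h` (and `G` has a Følner
sequence). -/
def HasTopologicalEntropy [MeasurableSpace G] (Y : Subshift A G) (h : ℝ) : Prop :=
  (∃ F : ℕ → Finset G,
    IsAddFoelner G (Measure.count : Measure G) atTop (fun n => (F n : Set G))) ∧
  ∀ F : ℕ → Finset G,
    IsAddFoelner G (Measure.count : Measure G) atTop (fun n => (F n : Set G)) →
      Tendsto (fun n => Real.log (blockCount Y (F n)) / ((F n).card : ℝ)) atTop (𝓝 h)

end Subshifts

/-! ### Odometers -/

section Odometers

/-- A decreasing sequence of finite index subgroups of `G`. -/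
structure OdometerSequence (G : Type*) [AddCommGroup G] where
  Γ : ℕ → AddSubgroup G
  le : ∀ n, Γ (n + 1) ≤ Γ n
  finiteIndex : ∀ n, (Γ n).FiniteIndex

variable {G : Type*} [AddCommGroup G]

/-- The `G`-odometer of a decreasing sequence of finite index subgroups: the inverse limit of the
finite groups `G ⧸ Γ n` along the natural maps `G ⧸ Γ (n + 1) → G ⧸ Γ n`. -/
def Odometer (S : OdometerSequence G) : Type _ :=
  {z : ∀ n, G ⧸ S.Γ n //
    ∀ n, AddSubgroup.quotientMapOfLE (S.le n) (z (n + 1)) = z n}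

/-- `G` acts on the odometer by translation in every coordinate. -/
instance Odometer.instAddAction (S : OdometerSequence G) : AddAction G (Odometer S) where
  vadd g z := ⟨fun n => (g : G ⧸ S.Γ n) + z.1 n, fun n => by
    have key : ∀ a : G ⧸ S.Γ (n + 1), AddSubgroup.quotientMapOfLE (S.le n) ((g : G ⧸ S.Γ (n + 1)) + a)
        = (g : G ⧸ S.Γ n) + AddSubgroup.quotientMapOfLE (S.le n) a := fun a =>
      QuotientAddGroup.induction_on a fun _ => rfl
    exact (key _).trans (congrArg _ (z.2 n))⟩
  zero_vadd z := Subtype.ext (funext fun n => zero_add (z.1 n))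
  add_vadd g h z := Subtype.ext (funext fun n => add_assoc (g : G ⧸ S.Γ n) h (z.1 n))

/-- The topology induced by the product of the discrete topologies on the `G ⧸ Γ n`. -/
instance Odometer.instTopologicalSpace (S : OdometerSequence G) :
    TopologicalSpace (Odometer S) :=
  letI : ∀ n, TopologicalSpace (G ⧸ S.Γ n) := fun _ => ⊥
  inferInstanceAs (TopologicalSpace {z : ∀ n, G ⧸ S.Γ n //
    ∀ n, AddSubgroup.quotientMapOfLE (S.le n) (z (n + 1)) = z n})

instance Odometer.instT2Space (S : OdometerSequence G) : T2Space (Odometer S) := by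
  let : ∀ n, TopologicalSpace (G ⧸ S.Γ n) := fun _ => ⊥
  have : ∀ n, DiscreteTopology (G ⧸ S.Γ n) := fun _ => ⟨rfl⟩
  exact inferInstanceAs (T2Space {z : ∀ n, G ⧸ S.Γ n //
    ∀ n, AddSubgroup.quotientMapOfLE (S.le n) (z (n + 1)) = z n})

instance Odometer.instCompactSpace (S : OdometerSequence G) : CompactSpace (Odometer S) := by
  let : ∀ n, TopologicalSpace (G ⧸ S.Γ n) := fun _ => ⊥
  have : ∀ n, DiscreteTopology (G ⧸ S.Γ n) := fun _ => ⟨rfl⟩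
  have : ∀ n, Finite (G ⧸ S.Γ n) := fun n =>
    have := S.finiteIndex n
    inferInstance
  have hc : IsClosed {z : ∀ n, G ⧸ S.Γ n |
      ∀ n, AddSubgroup.quotientMapOfLE (S.le n) (z (n + 1)) = z n} := by
    simp only [Set.ofPred_forall]
    exact isClosed_iInter fun n => isClosed_eq
      (continuous_of_discreteTopology.comp (continuous_apply (n + 1))) (continuous_apply n)
  exact isCompact_iff_compactSpace.mp hc.isCompact

instance Odometer.instContinuousConstVAdd (S : OdometerSequence G) :
    ContinuousConstVAdd G (Odometer S) where
  continuous_const_vadd g := by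
    let : ∀ n, TopologicalSpace (G ⧸ S.Γ n) := fun _ => ⊥
    have : ∀ n, DiscreteTopology (G ⧸ S.Γ n) := fun _ => ⟨rfl⟩
    refine Continuous.subtype_mk (continuous_pi fun n => ?_) _
    exact (continuous_of_discreteTopology (f := fun a : G ⧸ S.Γ n => (g : G ⧸ S.Γ n) + a)).comp
      ((continuous_apply n).comp continuous_subtype_val)

/-- The odometer of `S` is universal: every `G`-odometer is a factor of it. -/
def IsUniversalOdometer (S : OdometerSequence G) : Prop :=
  ∀ S' : OdometerSequence G, ∃ π : Odometer S → Odometer S', IsFactorMap G π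

end Odometers

/-!
The array is built from nested tilings of `ℤ ^ d` by cubes, the tiles of level `n` being the
translates of a cube `D n` by the elements of `Γ n = N n ℤ ^ d`, together with families `B n` of
blocks on `D n`. A block of level `n + 1` is a concatenation of blocks of level `n` in which a fixed
block `a n` occupies the tile over `0` and every block of level `n` occurs equally often
(`BlockScheme`). The blocks `a n` extend each other, and their union is the array `point`.

* Since `a n` sits on `D n + Γ (n + 1)`, the array is Toeplitz. The only array of the orbit closure
  whose tiles of all levels are at the standard position is `point` itself, which also gives
  minimality.
* Recognizability (`sub_mem_of_aligned`): for `e ∈ Γ n \ Γ (n + 1)` some block of level `n + 1` does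
  not carry `a n` at `e`, and all blocks occur in every array, so the position of the tiles of each
  level is determined by the array. This defines a factor map onto the odometer of `(Γ n)` with a
  one-point fibre at `point`. Points of the same fibre are then proximal, so every equicontinuous
  factor factors through the odometer (`isMaximalEquicontinuousFactor_of_fiber`). Every `n + 1`
  divides `N (n + 1)`, so the odometer is universal.
* For an invariant measure, the arrays carrying a given block of level `n` on `D n` have a measure
  independent of the block (`measure_cell`), because the block occurs equally often in all blocks of
  level `n + 1`. Up to boundary effects this determines the measure of cylinders. An invariant
  measure exists by averaging along the Følner sequence `D n`.
* The numbers of blocks are chosen so that `h |D n| < log |B n| ≤ h |D n| + log 2` for `n ≥ 1`. This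
  is possible since the number of equidistributed concatenations has exponential growth rate
  `log |B n|` (`pow_le_card_equidistributed`). Covering a finite set `F` by tiles bounds the number
  of patterns on `F` from above (`log_blockCount_le`); for the lower bound, Shearer's inequality for
  the covering of `D n` by the translates of `F` gives `h |F| ≤ log θ_F` for all finite `F`
  (`card_mul_log_card_le`).
-/

set_option linter.unusedSectionVars false

/-! ### Towers of tilings and block schemes -/

/-- A tiling of `G` by the translates of the finite set `D` by the elements of the subgroup `Γ`.
The projection `P` maps a point to the element of `Γ` whose tile contains it. -/
structure Tiling (G : Type*) [AddCommGroup G] where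
  Γ : AddSubgroup G
  P : G → G
  D : Finset G
  P_mem : ∀ g, P g ∈ Γ
  P_add : ∀ g, ∀ γ ∈ Γ, P (g + γ) = P g + γ
  P_zero : P 0 = 0
  mem_D : ∀ g, g ∈ D ↔ P g = 0

namespace Tiling

variable {G A : Type*} [AddCommGroup G] (S S' : Tiling G)

lemma P_add_left (g : G) {γ : G} (h : γ ∈ S.Γ) : S.P (γ + g) = γ + S.P g := by
  rw [add_comm, S.P_add g γ h, add_comm]

lemma P_of_mem {γ : G} (h : γ ∈ S.Γ) : S.P γ = γ := by
  have := S.P_add_left 0 h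
  rwa [add_zero, S.P_zero, add_zero] at this

lemma sub_P_mem_D (g : G) : g - S.P g ∈ S.D := by
  rw [S.mem_D, sub_eq_add_neg, S.P_add g _ (neg_mem (S.P_mem g)), add_neg_cancel]

/-- Periodic functions which agree on one tile are equal. -/
lemma ext_of_periodic {A : Type*} {b c : G → A} (hb : ∀ g, ∀ γ ∈ S.Γ, b (g + γ) = b g)
    (hc : ∀ g, ∀ γ ∈ S.Γ, c (g + γ) = c g) {e : G} (he : e ∈ S.Γ)
    (hbc : ∀ g, S.P g = e → b g = c g) : b = c := by
  funext g
  have h := hbc (g + (e - S.P g)) (by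
    rw [S.P_add _ _ (sub_mem he (S.P_mem g)), add_sub_cancel])
  rwa [hb _ _ (sub_mem he (S.P_mem g)), hc _ _ (sub_mem he (S.P_mem g))] at h

/-- `S'` is coarser than `S`: its tiles are unions of tiles of `S`. -/
structure Coarser : Prop where
  le : S'.Γ ≤ S.Γ
  P_P : ∀ g, S'.P (S.P g) = S'.P g

/-- The relation between the block families of two consecutive levels in a `BlockScheme`. A block
is a pattern on the tile over `0`, encoded as a periodic function on `G`. Every block in `B'` is a
concatenation of blocks in `B`, with `a` on the middle tile, in which each block of `B` occurs
exactly `t` times; `distinct` says that no other tile carries `a` in all blocks of `B'`. -/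
structure BlockStep (S S' : Tiling G) (B B' : Finset (G → A)) (a : G → A) (t : ℕ) : Prop where
  a_mem : a ∈ B
  t_pos : 0 < t
  concat : ∀ b ∈ B', ∀ u ∈ S.Γ, ∃ c ∈ B, ∀ g, S.P g = u → b g = c g
  center : ∀ b ∈ B', ∀ g, S.P g = 0 → b g = a g
  count : ∀ b ∈ B', ∀ c ∈ B,
    {e : G | e ∈ S'.D ∧ e ∈ S.Γ ∧ ∀ g, S.P g = e → b g = c g}.ncard = t
  distinct : ∀ e ∈ S.Γ, e ∉ S'.Γ → ∃ b ∈ B', ∃ g ∈ S.D, b (e + g) ≠ a g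

end Tiling

/-- A sequence of tilings, each coarser than the preceding one, starting with the tiling by points.
The tiles `D n` over `0` exhaust `G` and form a Følner sequence. -/
structure Tower (G : Type*) [AddCommGroup G] where
  tiling : ℕ → Tiling G
  Γ_zero : (tiling 0).Γ = ⊤
  coarser : ∀ n, (tiling n).Coarser (tiling (n + 1))
  exhaust : ∀ g, ∃ n, (tiling n).P g = 0
  foelner : ∀ g, Tendsto (fun n => (({r | r ∈ (tiling n).D ∧ r + g ∉ (tiling n).D} :
    Set G).ncard : ℝ) / (tiling n).D.card) atTop (𝓝 0)

namespace Tower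

variable {G : Type*} [AddCommGroup G] (T : Tower G)

/-- The subgroup of level `n` of a tower. -/
abbrev Γ (n : ℕ) : AddSubgroup G := (T.tiling n).Γ

/-- The projection of level `n` of a tower. -/
abbrev P (n : ℕ) : G → G := (T.tiling n).P

/-- The tile of level `n` over `0` of a tower. -/
abbrev D (n : ℕ) : Finset G := (T.tiling n).D

lemma anti (n : ℕ) : T.Γ (n + 1) ≤ T.Γ n := (T.coarser n).le

lemma P_mem (n : ℕ) (g : G) : T.P n g ∈ T.Γ n := (T.tiling n).P_mem g

lemma P_add (n : ℕ) (g : G) : ∀ γ ∈ T.Γ n, T.P n (g + γ) = T.P n g + γ := (T.tiling n).P_add g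

lemma P_zero (n : ℕ) : T.P n 0 = 0 := (T.tiling n).P_zero

lemma P_succ (n : ℕ) (g : G) : T.P (n + 1) (T.P n g) = T.P (n + 1) g := (T.coarser n).P_P g

lemma mem_D (n : ℕ) (g : G) : g ∈ T.D n ↔ T.P n g = 0 := (T.tiling n).mem_D g

lemma zero_mem_D (n : ℕ) : (0 : G) ∈ T.D n := (T.mem_D n 0).2 (T.P_zero n)

lemma D_card_pos (n : ℕ) : 0 < (T.D n).card := Finset.card_pos.2 ⟨0, T.zero_mem_D n⟩

lemma P_of_mem {n : ℕ} {γ : G} (h : γ ∈ T.Γ n) : T.P n γ = γ := (T.tiling n).P_of_mem h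

lemma P_add_left (n : ℕ) (g : G) {γ : G} (h : γ ∈ T.Γ n) : T.P n (γ + g) = γ + T.P n g :=
  (T.tiling n).P_add_left g h

lemma sub_P_mem_D (n : ℕ) (g : G) : g - T.P n g ∈ T.D n := (T.tiling n).sub_P_mem_D g

lemma P_P {n m : ℕ} (h : n ≤ m) (g : G) : T.P m (T.P n g) = T.P m g := by
  induction m, h using Nat.le_induction with
  | base => exact T.P_of_mem (T.P_mem n g)
  | succ m _ ih => rw [← T.P_succ m (T.P n g), ih, T.P_succ]

lemma P_eq_zero_mono {n m : ℕ} (h : n ≤ m) {g : G} (hg : T.P n g = 0) : T.P m g = 0 := by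
  rw [← T.P_P h, hg, T.P_zero]

/-- Two points of the same tile which are congruent modulo `Γ n` are equal. -/
lemma eq_of_mem_D {n : ℕ} {r s : G} (hr : r ∈ T.D n) (hs : s ∈ T.D n) (h : r - s ∈ T.Γ n) :
    r = s := by
  have := T.P_add n s _ h
  rw [add_sub_cancel, (T.mem_D n r).1 hr, (T.mem_D n s).1 hs, zero_add] at this
  exact (sub_eq_zero.1 this.symm)

lemma finiteIndex (n : ℕ) : (T.Γ n).FiniteIndex := by
  have : Finite (G ⧸ T.Γ n) := by
    refine Finite.of_surjective (fun r : T.D n => ((r : G) : G ⧸ T.Γ n)) fun z => ?_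
    induction z using QuotientAddGroup.induction_on with
    | _ g =>
      refine ⟨⟨g - T.P n g, T.sub_P_mem_D n g⟩, ?_⟩
      rw [QuotientAddGroup.eq]
      simpa using T.P_mem n g
  exact AddSubgroup.finiteIndex_of_finite_quotient

end Tower

/-- A tower of tilings together with finite families of blocks `B n` on the tiles of level `n`. A
block on the tile `D n` is encoded by its `Γ n`-periodic extension to `G`. Blocks of level `n + 1`
are concatenations of blocks of level `n`, with the distinguished block `a n` in the middle and
with every block of level `n` occurring exactly `t n` times. -/
structure BlockScheme (G A : Type*) [AddCommGroup G] extends Tower G where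
  B : ℕ → Finset (G → A)
  a : ℕ → G → A
  t : ℕ → ℕ
  periodic : ∀ n, ∀ b ∈ B n, ∀ g, ∀ γ ∈ (tiling n).Γ, b (g + γ) = b g
  step : ∀ n, (tiling n).BlockStep (tiling (n + 1)) (B n) (B (n + 1)) (a n) (t n)

namespace BlockScheme

variable {G A : Type*} [AddCommGroup G] (T : BlockScheme G A)

lemma a_mem (n : ℕ) : T.a n ∈ T.B n := (T.step n).a_mem

lemma center (n : ℕ) : ∀ b ∈ T.B (n + 1), ∀ g, T.P n g = 0 → b g = T.a n g := (T.step n).center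

lemma periodic_left {n : ℕ} {b : G → A} (hb : b ∈ T.B n) {γ : G} (hγ : γ ∈ T.Γ n) (g : G) :
    b (γ + g) = b g := by
  rw [add_comm, T.periodic n b hb g γ hγ]

lemma a_eq_of_le {n m : ℕ} (h : n ≤ m) {g : G} (hg : T.P n g = 0) : T.a m g = T.a n g := by
  induction m, h using Nat.le_induction with
  | base => rfl
  | succ m hm ih => rw [← ih, T.center m _ (T.a_mem (m + 1)) g (T.P_eq_zero_mono hm hg)]

/-- The array whose restriction to the tile `D n` is the block `a n`, for all `n`. -/
noncomputable def point (g : G) : A := T.a (T.exhaust g).choose g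

lemma point_eq {n : ℕ} {g : G} (hg : T.P n g = 0) : T.point g = T.a n g := by
  have h := (T.exhaust g).choose_spec
  rcases le_total n (T.exhaust g).choose with hle | hle
  · exact T.a_eq_of_le hle hg
  · exact (T.a_eq_of_le hle h).symm

/-- On every tile of level `n`, the array `y` agrees with a block of level `n`. -/
def Aligned (n : ℕ) (y : G → A) : Prop :=
  ∀ u ∈ T.Γ n, ∃ b ∈ T.B n, ∀ g, T.P n g = u → y g = b g

variable {T}

lemma Aligned.of_succ {n : ℕ} {y : G → A} (h : T.Aligned (n + 1) y) : T.Aligned n y := by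
  intro u hu
  obtain ⟨b, hb, hyb⟩ := h (T.P (n + 1) u) (T.P_mem _ _)
  obtain ⟨c, hc, hbc⟩ := (T.step n).concat b hb u hu
  refine ⟨c, hc, fun g hg => ?_⟩
  rw [hyb g (by rw [← T.P_succ, hg]), hbc g hg]

lemma Aligned.mono {n m : ℕ} (hnm : n ≤ m) {y : G → A} (h : T.Aligned m y) : T.Aligned n y := by
  induction m, hnm using Nat.le_induction with
  | base => exact h
  | succ m _ ih => exact ih h.of_succ

lemma Aligned.shift {n : ℕ} {y : G → A} (h : T.Aligned n y) {γ : G} (hγ : γ ∈ T.Γ n) :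
    T.Aligned n (shift γ y) := by
  intro u hu
  obtain ⟨b, hb, hyb⟩ := h (γ + u) (add_mem hγ hu)
  refine ⟨b, hb, fun g hg => ?_⟩
  rw [shift_apply, hyb (γ + g) (by rw [T.P_add_left n g hγ, hg]), T.periodic_left hb hγ]

lemma Aligned.eq_a {n : ℕ} {y : G → A} (h : T.Aligned (n + 1) y) {γ g : G}
    (hγ : γ ∈ T.Γ (n + 1)) (hg : T.P n g = 0) : y (γ + g) = T.a n g := by
  obtain ⟨b, hb, hyb⟩ := h γ hγ
  rw [hyb (γ + g) (by rw [T.P_add_left _ g hγ, T.P_eq_zero_mono n.le_succ hg, add_zero]),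
    T.periodic_left hb hγ, T.center n b hb g hg]

variable (T)

lemma aligned_block {n m : ℕ} (h : n ≤ m) {b : G → A} (hb : b ∈ T.B m) : T.Aligned n b := by
  have : T.Aligned m b := fun u _ => ⟨b, hb, fun _ _ => rfl⟩
  exact this.mono h

lemma aligned_point (n : ℕ) : T.Aligned n T.point := by
  intro u hu
  obtain ⟨m, hm⟩ := T.exhaust u
  have hm' : T.P (max n m) u = 0 := T.P_eq_zero_mono (le_max_right n m) hm
  obtain ⟨b, hb, hab⟩ := T.aligned_block (le_max_left n m) (T.a_mem (max n m)) u hu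
  refine ⟨b, hb, fun g hg => ?_⟩
  rw [← hab g hg]
  refine T.point_eq ?_
  rw [← T.P_P (le_max_left n m), hg, hm']

/-- A point of the tile `D n` is constant along a coset of `Γ (n + 1)`, since the tile of level
`n` in the middle of a tile of level `n + 1` always carries the block `a n`. -/
lemma isToeplitz_point : IsToeplitz T.point := by
  intro g
  obtain ⟨n, hn⟩ := T.exhaust g
  refine ⟨T.Γ (n + 1), T.finiteIndex _, fun γ hγ => ?_⟩
  rw [add_comm, (T.aligned_point (n + 1)).eq_a hγ hn, T.point_eq hn]

/-- An array aligned to the tiles of all levels is the distinguished one. -/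
lemma eq_point_of_aligned {y : G → A} (h : ∀ n, T.Aligned n y) : y = T.point := by
  funext g
  obtain ⟨n, hn⟩ := T.exhaust g
  have := (h (n + 1)).eq_a (zero_mem _) hn
  rw [zero_add] at this
  rw [this, T.point_eq hn]

/-- All blocks of level `n` occur in an array aligned to the tiles of level `n + 1`. -/
lemma Aligned.exists_occurrence {T : BlockScheme G A} {n : ℕ} {y : G → A}
    (h : T.Aligned (n + 1) y) {b : G → A}
    (hb : b ∈ T.B n) : ∃ u ∈ T.Γ n, ∀ g, T.P n g = u → y g = b g := by
  obtain ⟨c, hc, hyc⟩ := h 0 (zero_mem _)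
  have hpos : 0 < {e : G | e ∈ T.D (n + 1) ∧ e ∈ T.Γ n ∧ ∀ g, T.P n g = e → c g = b g}.ncard := by
    rw [(T.step n).count c hc b hb]; exact (T.step n).t_pos
  obtain ⟨e, he, heΓ, hce⟩ := Set.nonempty_of_ncard_ne_zero hpos.ne'
  refine ⟨e, heΓ, fun g hg => ?_⟩
  rw [hyc g (by rw [← T.P_succ, hg, (T.mem_D _ e).1 he]), hce g hg]

section Topology

variable [TopologicalSpace A] [DiscreteTopology A]

lemma isClosed_aligned (n : ℕ) : IsClosed {y | T.Aligned n y} := by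
  have : {y | T.Aligned n y} = ⋂ u ∈ T.Γ n, ⋃ b ∈ T.B n, {y | ∀ g, T.P n g = u → y g = b g} := by
    ext y; simp [Aligned]
  rw [this]
  refine isClosed_biInter fun u _ => (T.B n).finite_toSet.isClosed_biUnion fun b _ => ?_
  have : {y : G → A | ∀ g, T.P n g = u → y g = b g} =
      ⋂ g, ⋂ (_ : T.P n g = u), (fun y : G → A => y g) ⁻¹' {b g} := by
    ext y; simp
  rw [this]
  exact isClosed_iInter fun g => isClosed_iInter fun _ =>
    (isClosed_discrete _).preimage (continuous_apply g)

lemma mem_orbitClosure_self (x : G → A) : x ∈ (orbitClosure x).carrier :=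
  subset_closure ⟨0, shift_zero x⟩

lemma exists_aligned (n : ℕ) {y : G → A} (hy : y ∈ (orbitClosure T.point).carrier) :
    ∃ r ∈ T.D n, T.Aligned n (shift (-r) y) := by
  have hcl : IsClosed (⋃ r ∈ T.D n, {y : G → A | T.Aligned n (shift (-r) y)}) :=
    (T.D n).finite_toSet.isClosed_biUnion fun r _ =>
      (T.isClosed_aligned n).preimage (continuous_shift (-r))
  have hsub : (Set.range fun g : G => shift g T.point) ⊆
      ⋃ r ∈ T.D n, {y : G → A | T.Aligned n (shift (-r) y)} := by
    rintro _ ⟨g, rfl⟩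
    simp only [Set.mem_iUnion]
    refine ⟨g - T.P n g, T.sub_P_mem_D n g, ?_⟩
    have : shift (-(g - T.P n g)) (shift g T.point) = shift (T.P n g) T.point := by
      rw [← shift_add]; congr 1; abel
    change T.Aligned n _
    rw [this]
    exact (T.aligned_point n).shift (T.P_mem n g)
  have := closure_minimal hsub hcl hy
  simpa using this

/-- Recognizability: the position of the tiles of level `n` is determined by the array. -/
lemma sub_mem_of_aligned (n : ℕ) : ∀ {y : G → A}, y ∈ (orbitClosure T.point).carrier →
    ∀ {c c' : G}, T.Aligned n (shift c y) → T.Aligned n (shift c' y) → c - c' ∈ T.Γ n := by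
  induction n with
  | zero => intro y _ c c' _ _; change _ ∈ (T.tiling 0).Γ; rw [T.Γ_zero]; trivial
  | succ n ih =>
    have key : ∀ {y : G → A}, y ∈ (orbitClosure T.point).carrier → ∀ {e : G},
        T.Aligned (n + 2) y → T.Aligned (n + 1) (shift e y) → e ∈ T.Γ (n + 1) := by
      intro y hy e h2 h1
      have he : e ∈ T.Γ n := by
        simpa using ih hy h1.of_succ (c' := 0) (by simpa using h2.of_succ.of_succ)
      by_contra hne
      obtain ⟨b, hb, g, hg, hbg⟩ := (T.step n).distinct e he hne
      obtain ⟨v, hv, hyv⟩ := h2.exists_occurrence hb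
      have hg0 := (T.mem_D n g).1 hg
      have hw := T.P_mem (n + 1) e
      have hvw : v - T.P (n + 1) e ∈ T.Γ (n + 1) := sub_mem hv hw
      have e1 := h1.eq_a hvw hg0
      rw [shift_apply] at e1
      have e2 := hyv (e + (v - T.P (n + 1) e + g)) (by
        have : e + (v - T.P (n + 1) e + g) = (v - T.P (n + 1) e) + (e + g) := by abel
        rw [this, T.P_add_left _ _ hvw, ← T.P_succ n (e + g), T.P_add_left _ _ he, hg0, add_zero]
        abel)
      have : e + (v - T.P (n + 1) e + g) = (v - T.P (n + 1) e) + (e + g) := by abel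
      rw [e1, this, T.periodic_left hb hvw] at e2
      exact hbg e2.symm
    intro y hy c c' h h'
    obtain ⟨r, -, hr⟩ := T.exists_aligned (n + 2) hy
    have hy' := (orbitClosure T.point).mapsTo (-r) hy
    have sh : ∀ c : G, shift c y = shift (c + r) (shift (-r) y) := fun c => by
      rw [← shift_add]; congr 1; abel
    rw [sh] at h h'
    have := sub_mem (key hy' hr h) (key hy' hr h')
    simpa using this

end Topology

end BlockScheme

/-! ### Odometers -/

namespace Odometer

variable {G : Type*} [AddCommGroup G] {S : OdometerSequence G}

/-- The point of the odometer given by the cosets of `0`. -/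
def base (S : OdometerSequence G) : Odometer S := ⟨fun _ => 0, fun _ => rfl⟩

lemma vadd_val (g : G) (z : Odometer S) (n : ℕ) :
    (g +ᵥ z).1 n = (g : G ⧸ S.Γ n) + z.1 n := rfl

lemma val_eq_of_le {n m : ℕ} (h : n ≤ m) (z : Odometer S) {g : G} (hg : z.1 m = g) :
    z.1 n = g := by
  induction m, h using Nat.le_induction with
  | base => exact hg
  | succ m _ ih => exact ih (by rw [← z.2 m, hg]; rfl)

lemma val_eq_val_of_le {n m : ℕ} (h : n ≤ m) {z w : Odometer S} (hzw : z.1 m = w.1 m) :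
    z.1 n = w.1 n := by
  obtain ⟨g, hg⟩ := QuotientAddGroup.mk_surjective (z.1 m)
  rw [val_eq_of_le h z hg.symm, val_eq_of_le h w (hzw ▸ hg.symm)]

lemma isOpen_val_eq (n : ℕ) (a : G ⧸ S.Γ n) : IsOpen {z : Odometer S | z.1 n = a} := by
  let : ∀ n, TopologicalSpace (G ⧸ S.Γ n) := fun _ => ⊥
  have : ∀ n, DiscreteTopology (G ⧸ S.Γ n) := fun _ => ⟨rfl⟩
  have hc : Continuous fun z : Odometer S => z.1 n :=
    (continuous_apply n).comp continuous_subtype_val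
  exact (isOpen_discrete {a}).preimage hc

/-- Continuity of a map into an odometer is local constancy of its coordinates. -/
lemma continuous_of_isOpen {X : Type*} [TopologicalSpace X] {f : X → Odometer S}
    (h : ∀ n (a : G ⧸ S.Γ n), IsOpen {x | (f x).1 n = a}) : Continuous f := by
  let : ∀ n, TopologicalSpace (G ⧸ S.Γ n) := fun _ => ⊥
  have : ∀ n, DiscreteTopology (G ⧸ S.Γ n) := fun _ => ⟨rfl⟩
  have h1 : Continuous fun x => (f x).1 :=
    continuous_pi fun n => continuous_discrete_rng.2 fun a => h n a
  exact h1.subtype_mk fun x => (f x).2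

/-- Every nonempty open set contains the set of points with some prescribed coordinate. -/
lemma exists_val_subset {U : Set (Odometer S)} (hU : IsOpen U) {z : Odometer S} (hz : z ∈ U) :
    ∃ n, {w : Odometer S | w.1 n = z.1 n} ⊆ U := by
  refine exists_subset_nhds_of_isCompact (V := fun n => {w : Odometer S | w.1 n = z.1 n})
    (directed_of_isDirected_le fun n m h w hw => val_eq_val_of_le h hw) (fun n => ?_) ?_
  · have : IsClosed {w : Odometer S | w.1 n = z.1 n} := by
      have := S.finiteIndex n
      have e : {w : Odometer S | w.1 n = z.1 n} = (⋃ a ∈ {a | a ≠ z.1 n}, {w | w.1 n = a})ᶜ := by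
        ext w; simp [not_imp_not]
      rw [e, isClosed_compl_iff]
      exact isOpen_biUnion fun a _ => isOpen_val_eq n a
    exact this.isCompact
  · intro w hw
    simp only [Set.mem_iInter, Set.mem_ofPred_eq] at hw
    have : w = z := Subtype.ext (funext hw)
    exact this ▸ hU.mem_nhds hz

/-- An odometer has dense orbits. -/
lemma dense_orbit (z : Odometer S) : Dense (Set.range fun g : G => g +ᵥ z) := by
  intro w
  rw [mem_closure_iff]
  intro U hU hw
  obtain ⟨n, hn⟩ := exists_val_subset hU hw
  obtain ⟨g, hg⟩ := QuotientAddGroup.mk_surjective (w.1 n - z.1 n)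
  refine ⟨g +ᵥ z, hn ?_, g, rfl⟩
  change (g +ᵥ z).1 n = w.1 n
  rw [vadd_val, hg, sub_add_cancel]

/-- A continuous equivariant map from a nonempty compact system to an odometer is a factor map. -/
lemma isFactorMap_of_continuous {X : Type*} [TopologicalSpace X] [CompactSpace X] [Nonempty X]
    [AddAction G X] {f : X → Odometer S} (hf : Continuous f)
    (hv : ∀ (g : G) (x : X), f (g +ᵥ x) = g +ᵥ f x) : IsFactorMap G f := by
  refine ⟨hf, ?_, hv⟩
  obtain ⟨x⟩ := ‹Nonempty X›
  rw [← Set.range_eq_univ]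
  refine (isCompact_range hf).isClosed.closure_eq.symm.trans
    ((Dense.mono ?_ (dense_orbit (f x))).closure_eq)
  rintro _ ⟨g, rfl⟩
  exact ⟨g +ᵥ x, hv g x⟩

lemma isEquicontinuousSystem (S : OdometerSequence G) :
    IsEquicontinuousSystem G (Odometer S) := by
  unfold IsEquicontinuousSystem
  let : UniformSpace (Odometer S) := uniformSpaceOfCompactR1
  intro U hU
  rw [← nhdsSet_diagonal_eq_uniformity, mem_nhdsSet_iff_forall] at hU
  have hclosed : ∀ n, IsClosed {p : Odometer S × Odometer S | p.1.1 n = p.2.1 n} := fun n => by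
    rw [← isOpen_compl_iff]
    have e : {p : Odometer S × Odometer S | p.1.1 n = p.2.1 n}ᶜ =
        ⋃ q : {q : (G ⧸ S.Γ n) × (G ⧸ S.Γ n) // q.1 ≠ q.2},
          {w : Odometer S | w.1 n = q.1.1} ×ˢ {w : Odometer S | w.1 n = q.1.2} := by
      ext p
      simp only [Set.mem_compl_iff, Set.mem_ofPred_eq, Set.mem_iUnion, Set.mem_prod]
      exact ⟨fun h => ⟨⟨(_, _), h⟩, rfl, rfl⟩, fun ⟨q, h1, h2⟩ h => q.2 (h1 ▸ h2 ▸ h)⟩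
    rw [e]
    exact isOpen_iUnion fun q => (isOpen_val_eq n _).prod (isOpen_val_eq n _)
  -- The sets of pairs agreeing in coordinate `n` are invariant and shrink to the diagonal.
  obtain ⟨n, hn⟩ : ∃ n, {p : Odometer S × Odometer S | p.1.1 n = p.2.1 n} ⊆ U := by
    refine exists_subset_nhds_of_isCompact
      (V := fun n => {p : Odometer S × Odometer S | p.1.1 n = p.2.1 n})
      (directed_of_isDirected_le fun n m h w hw => val_eq_val_of_le h hw)
      (fun n => (hclosed n).isCompact) ?_
    rintro ⟨z, w⟩ h
    simp only [Set.mem_iInter, Set.mem_ofPred_eq] at h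
    obtain rfl : z = w := Subtype.ext (funext h)
    exact hU _ rfl
  have h2 : {p : Odometer S × Odometer S | p.1.1 n = p.2.1 n} ∈ uniformity (Odometer S) := by
    rw [← nhdsSet_diagonal_eq_uniformity, mem_nhdsSet_iff_forall]
    rintro ⟨z, w⟩ (rfl : z = w)
    exact mem_of_superset (prod_mem_nhds ((isOpen_val_eq n (z.1 n)).mem_nhds rfl)
      ((isOpen_val_eq n (z.1 n)).mem_nhds rfl)) fun p hp => hp.1.trans hp.2.symm
  refine mem_of_superset h2 fun p hp g => hn ?_
  change (g +ᵥ p.1).1 n = (g +ᵥ p.2).1 n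
  rw [vadd_val, vadd_val, show p.1.1 n = p.2.1 n from hp]

/-- An odometer whose subgroups are cofinal among the finite index subgroups is universal. -/
lemma isUniversalOdometer_of_cofinal
    (h : ∀ Δ : AddSubgroup G, Δ.FiniteIndex → ∃ n, S.Γ n ≤ Δ) : IsUniversalOdometer S := by
  intro S'
  choose φ hφ using fun j => h (S'.Γ j) (S'.finiteIndex j)
  have key : ∀ (z : Odometer S) (j : ℕ) (m : ℕ) (g : G), φ j ≤ m → z.1 m = g →
      AddSubgroup.quotientMapOfLE (hφ j) (z.1 (φ j)) = g := by
    intro z j m g hm hg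
    rw [val_eq_of_le hm z hg]; rfl
  let f : Odometer S → Odometer S' := fun z =>
    ⟨fun j => AddSubgroup.quotientMapOfLE (hφ j) (z.1 (φ j)), fun j => by
      obtain ⟨g, hg⟩ := QuotientAddGroup.mk_surjective (z.1 (max (φ j) (φ (j + 1))))
      exact (congrArg _ (key z (j + 1) _ g (le_max_right _ _) hg.symm)).trans
        (key z j _ g (le_max_left _ _) hg.symm).symm⟩
  have : Nonempty (Odometer S) := ⟨base S⟩
  refine ⟨f, isFactorMap_of_continuous (continuous_of_isOpen fun j a => ?_) fun g z => ?_⟩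
  · have e : {z | (f z).1 j = a} = ⋃ b ∈ {b | AddSubgroup.quotientMapOfLE (hφ j) b = a},
        {z : Odometer S | z.1 (φ j) = b} := by
      ext z; simp [f]
    rw [e]
    exact isOpen_biUnion fun b _ => isOpen_val_eq _ b
  · refine Subtype.ext (funext fun j => ?_)
    obtain ⟨g', hg'⟩ := QuotientAddGroup.mk_surjective (z.1 (φ j))
    change AddSubgroup.quotientMapOfLE (hφ j) ((g : G ⧸ S.Γ (φ j)) + z.1 (φ j)) =
      (g : G ⧸ S'.Γ j) + AddSubgroup.quotientMapOfLE (hφ j) (z.1 (φ j))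
    rw [← hg']; rfl

end Odometer

/-! ### Maximal equicontinuous factors -/

section MaximalEquicontinuousFactor

variable {G : Type*} [AddCommGroup G]

/-- Equicontinuous systems are distal: points that are moved by the same group elements into any
given neighbourhood of a third point are equal. -/
lemma IsEquicontinuousSystem.eq_of_proximal {Z : Type*} [TopologicalSpace Z] [CompactSpace Z]
    [T2Space Z] [AddAction G Z] [ContinuousConstVAdd G Z] (hZ : IsEquicontinuousSystem G Z)
    {a b c : Z} (h : ∀ U ∈ 𝓝 c, ∃ g : G, g +ᵥ a ∈ U ∧ g +ᵥ b ∈ U) : a = b := by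
  let : UniformSpace Z := uniformSpaceOfCompactR1
  have hZ' : UniformEquicontinuous (fun (g : G) (x : Z) => g +ᵥ x) := hZ
  refine eq_of_uniformity fun {V} hV => ?_
  have h1 := hZ' V hV
  have h2 : {p : Z × Z | ∀ g : G, (g +ᵥ p.1, g +ᵥ p.2) ∈ V} ∈ 𝓝 (c, c) :=
    (nhds_le_uniformity c) h1
  rw [nhds_prod_eq, mem_prod_self_iff] at h2
  obtain ⟨U, hU, hUV⟩ := h2
  obtain ⟨g, ha, hb⟩ := h U hU
  have := hUV (Set.mk_mem_prod ha hb) (-g)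
  simpa using this

/-- A factor map with a one-point fibre onto a minimal equicontinuous system identifies that system
as the maximal equicontinuous factor. -/
lemma isMaximalEquicontinuousFactor_of_fiber {X Y : Type*}
    [TopologicalSpace X] [CompactSpace X] [T2Space X] [AddAction G X] [ContinuousConstVAdd G X]
    [TopologicalSpace Y] [CompactSpace Y] [T2Space Y] [AddAction G Y] [ContinuousConstVAdd G Y]
    (hY : IsEquicontinuousSystem G Y) {π : X → Y} (hπ : IsFactorMap G π) {x : X}
    (hx : ∀ y, π y = π x → y = x)
    (hdense : ∀ z : Y, Dense (Set.range fun g : G => g +ᵥ z)) :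
    IsMaximalEquicontinuousFactor G X Y := by
  refine ⟨hY, π, hπ, fun Z _ _ _ _ _ hZ f hf => ?_⟩
  have hclosed : IsClosedMap π := hπ.continuous.isClosedMap
  have hfib : ∀ y y', π y = π y' → f y = f y' := by
    intro y y' hyy
    refine hZ.eq_of_proximal (c := f x) fun U hU => ?_
    obtain ⟨W, hWU, hW, hxW⟩ := mem_nhds_iff.1 (hf.continuous.continuousAt hU)
    -- The complement of the image of the complement of `W` is a neighbourhood of `π x`.
    have hO : IsOpen (π '' Wᶜ)ᶜ := (hclosed _ hW.isClosed_compl).isOpen_compl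
    obtain ⟨_, hg, g, rfl⟩ := (hdense (π y)).inter_open_nonempty _ hO ⟨π x, by
      rintro ⟨w, hw, hwx⟩
      exact hw (hx w hwx ▸ hxW)⟩
    have mem : ∀ w, π w = π y → g +ᵥ w ∈ W := by
      intro w hw
      by_contra hne
      exact hg ⟨g +ᵥ w, hne, by rw [hπ.map_vadd, hw]⟩
    exact ⟨g, by rw [← hf.map_vadd]; exact hWU (mem y rfl),
      by rw [← hf.map_vadd]; exact hWU (mem y' hyy.symm)⟩
  have hcomp : (fun z => f (Function.surjInv hπ.surjective z)) ∘ π = f :=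
    funext fun y => hfib _ _ (Function.surjInv_eq hπ.surjective (π y))
  refine ⟨fun z => f (Function.surjInv hπ.surjective z), ⟨?_, ?_, ?_⟩, hcomp⟩
  · rw [(hclosed.isQuotientMap hπ.continuous hπ.surjective).continuous_iff, hcomp]
    exact hf.continuous
  · intro z
    obtain ⟨y, rfl⟩ := hf.surjective z
    exact ⟨π y, congrFun hcomp y⟩
  · intro g z
    obtain ⟨y, rfl⟩ := hπ.surjective z
    have := congrFun hcomp
    simp only [Function.comp_apply] at this
    rw [← hπ.map_vadd, this, this, hf.map_vadd]

end MaximalEquicontinuousFactor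

/-! ### The odometer factor of a block scheme -/

namespace BlockScheme

variable {G A : Type*} [AddCommGroup G] (T : BlockScheme G A)

/-- The odometer of the subgroups of a block scheme. -/
def odometerSequence : OdometerSequence G where
  Γ := T.Γ
  le := T.anti
  finiteIndex := T.finiteIndex

variable [TopologicalSpace A] [DiscreteTopology A]

/-- The position in the tile `D n` at which the origin of an array of the orbit closure is
located. -/
noncomputable def position (n : ℕ) (y : (orbitClosure T.point).carrier) : G :=
  (T.exists_aligned n y.2).choose

lemma position_mem (n : ℕ) (y : (orbitClosure T.point).carrier) : T.position n y ∈ T.D n :=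
  (T.exists_aligned n y.2).choose_spec.1

lemma aligned_position (n : ℕ) (y : (orbitClosure T.point).carrier) :
    T.Aligned n (shift (-T.position n y) y.1) :=
  (T.exists_aligned n y.2).choose_spec.2

lemma aligned_iff (n : ℕ) (y : (orbitClosure T.point).carrier) (r : G) :
    T.Aligned n (shift (-r) y.1) ↔ r - T.position n y ∈ T.Γ n := by
  constructor
  · intro h
    have := T.sub_mem_of_aligned n y.2 (T.aligned_position n y) h
    simpa [add_comm, sub_eq_add_neg] using this
  · intro h
    have h2 := (T.aligned_position n y).shift (neg_mem h)
    rw [← shift_add] at h2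
    convert h2 using 2
    abel

lemma aligned_iff_position_eq {n : ℕ} {y : (orbitClosure T.point).carrier} {r : G}
    (hr : r ∈ T.D n) : T.Aligned n (shift (-r) y.1) ↔ T.position n y = r := by
  rw [aligned_iff]
  refine ⟨fun h => (T.eq_of_mem_D hr (T.position_mem n y) h).symm, ?_⟩
  rintro rfl
  simp

/-- The factor map onto the odometer: the coordinate of level `n` is the position of the origin
with respect to the tiles of level `n`. -/
noncomputable def toOdometer (y : (orbitClosure T.point).carrier) : Odometer T.odometerSequence :=
  ⟨fun n => ((T.position n y : G) : G ⧸ T.Γ n), fun n => by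
    change ((T.position (n + 1) y : G) : G ⧸ T.Γ n) = ((T.position n y : G) : G ⧸ T.Γ n)
    rw [QuotientAddGroup.eq_iff_sub_mem, ← T.aligned_iff]
    exact (T.aligned_position (n + 1) y).of_succ⟩

lemma toOdometer_eq_iff {n : ℕ} {y : (orbitClosure T.point).carrier} {r : G} :
    (T.toOdometer y).1 n = (r : G ⧸ T.Γ n) ↔ T.Aligned n (shift (-r) y.1) := by
  rw [aligned_iff]
  change ((T.position n y : G) : G ⧸ T.Γ n) = (r : G ⧸ T.Γ n) ↔ _
  rw [eq_comm, QuotientAddGroup.eq_iff_sub_mem]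

lemma position_vadd (n : ℕ) (g : G) (y : (orbitClosure T.point).carrier) :
    T.Aligned n (shift (-(g + T.position n y)) (g +ᵥ y).1) := by
  have : shift (-(g + T.position n y)) (g +ᵥ y).1 = shift (-T.position n y) y.1 := by
    change shift _ (shift g y.1) = _
    rw [← shift_add]; congr 1; abel
  rw [this]
  exact T.aligned_position n y

lemma isOpen_position_eq (n : ℕ) (r : G) : IsOpen {y | T.position n y = r} := by
  have hc : ∀ s ∈ T.D n, IsClosed {y : (orbitClosure T.point).carrier | T.position n y = s} := by
    intro s hs
    simp only [← T.aligned_iff_position_eq hs]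
    exact (T.isClosed_aligned n).preimage ((continuous_shift (-s)).comp continuous_subtype_val)
  have e : {y | T.position n y = r} = (⋃ s ∈ {s | s ∈ T.D n ∧ s ≠ r},
      {y | T.position n y = s})ᶜ := by
    ext y
    simp only [Set.mem_ofPred_eq, Set.mem_compl_iff, Set.mem_iUnion, not_exists]
    refine ⟨fun h s hs h' => hs.2 (h' ▸ h), fun h => ?_⟩
    by_contra hne
    exact h _ ⟨T.position_mem n y, hne⟩ rfl
  rw [e, isOpen_compl_iff]
  refine Set.Finite.isClosed_biUnion ((T.D n).finite_toSet.subset fun s hs => hs.1)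
    fun s hs => hc s hs.1

lemma isFactorMap_toOdometer [Finite A] : IsFactorMap G T.toOdometer := by
  have : Nonempty (orbitClosure T.point).carrier := ⟨⟨T.point, mem_orbitClosure_self _⟩⟩
  refine Odometer.isFactorMap_of_continuous (Odometer.continuous_of_isOpen fun n a => ?_) ?_
  · have e : {y | (T.toOdometer y).1 n = a} =
        ⋃ r ∈ {r : G | (r : G ⧸ T.Γ n) = a}, {y | T.position n y = r} := by
      ext y
      simp only [Set.mem_iUnion, Set.mem_ofPred_eq, exists_prop, exists_eq_right']
      rfl
    rw [e]
    exact isOpen_biUnion fun r _ => T.isOpen_position_eq n r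
  · intro g y
    refine Subtype.ext (funext fun n => ?_)
    exact T.toOdometer_eq_iff.2 (T.position_vadd n g y)

lemma eq_point_of_toOdometer_eq {y : (orbitClosure T.point).carrier}
    (h : T.toOdometer y = T.toOdometer ⟨T.point, mem_orbitClosure_self _⟩) :
    y = ⟨T.point, mem_orbitClosure_self _⟩ := by
  refine Subtype.ext (T.eq_point_of_aligned fun n => ?_)
  have h0 : T.Aligned n (shift (-(0 : G)) T.point) := by
    rw [neg_zero, shift_zero]; exact T.aligned_point n
  have := T.toOdometer_eq_iff (y := y) (r := 0) (n := n)
  rw [h, T.toOdometer_eq_iff, neg_zero, shift_zero, shift_zero] at this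
  exact this.1 (T.aligned_point n)

/-- The distinguished array is the only point of its fibre over the odometer, so that the odometer
is the maximal equicontinuous factor. -/
lemma isMaximalEquicontinuousFactor [Finite A] :
    IsMaximalEquicontinuousFactor G (orbitClosure T.point).carrier
      (Odometer T.odometerSequence) :=
  isMaximalEquicontinuousFactor_of_fiber (Odometer.isEquicontinuousSystem _)
    T.isFactorMap_toOdometer (fun _ => T.eq_point_of_toOdometer_eq) Odometer.dense_orbit

end BlockScheme

/-! ### Minimality and unique ergodicity -/

/-- On a compact metrizable space, averages of point masses along a Følner sequence accumulate at
an invariant probability measure. -/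
lemma exists_invariant_probabilityMeasure {G X : Type*} [AddCommGroup G] [TopologicalSpace X]
    [CompactSpace X] [T2Space X] [SecondCountableTopology X] [Nonempty X] [MeasurableSpace X]
    [BorelSpace X] [AddAction G X] [ContinuousConstVAdd G X] (D : ℕ → Finset G)
    (hD : ∀ n, 0 < (D n).card)
    (hF : ∀ g, Tendsto (fun n => (({r | r ∈ D n ∧ r + g ∉ D n} : Set G).ncard : ℝ) / (D n).card)
      atTop (𝓝 0)) :
    ∃ μ : Measure X, IsProbabilityMeasure μ ∧ VAddInvariantMeasure G X μ := by
  classical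
  obtain ⟨x⟩ := ‹Nonempty X›
  let μ : ℕ → Measure X := fun n =>
    ((D n).card : NNReal)⁻¹ • ∑ r ∈ D n, Measure.dirac (r +ᵥ x)
  have hprob : ∀ n, IsProbabilityMeasure (μ n) := fun n => ⟨by
    have h0 : ((D n).card : NNReal) ≠ 0 := by exact_mod_cast (hD n).ne'
    simp only [μ, Measure.smul_apply, Measure.finsetSum_apply, measure_univ, Finset.sum_const,
      nsmul_eq_mul, mul_one, ENNReal.smul_def, smul_eq_mul]
    rw [ENNReal.coe_inv h0]
    exact ENNReal.inv_mul_cancel (by simpa using h0) (by simp)⟩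
  have hint : ∀ n (f : BoundedContinuousFunction X ℝ),
      ∫ y, f y ∂μ n = ((D n).card : ℝ)⁻¹ * ∑ r ∈ D n, f (r +ᵥ x) := by
    intro n f
    simp only [μ]
    rw [integral_smul_nnreal_measure, integral_finsetSum_measure]
    · simp [NNReal.smul_def]
    · exact fun r _ => f.integrable _
  let u : Ultrafilter ℕ := Ultrafilter.of atTop
  have hu : (u : Filter ℕ) ≤ atTop := Ultrafilter.of_le _
  let ν : ℕ → ProbabilityMeasure X := fun n => ⟨μ n, hprob n⟩
  have hlim : Tendsto ν u (𝓝 (u.map ν).lim) := (u.map ν).le_nhds_lim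
  set m := (u.map ν).lim
  rw [ProbabilityMeasure.tendsto_iff_forall_integral_tendsto] at hlim
  refine ⟨m, inferInstance, ⟨fun g s hs => ?_⟩⟩
  have hmg : Measurable fun y : X => g +ᵥ y := (continuous_const_vadd g).measurable
  suffices hm : (m : Measure X).map (fun y => g +ᵥ y) = m by
    rw [← Measure.map_apply hmg hs, hm]
  let := TopologicalSpace.metrizableSpaceMetric X
  have := Measure.isProbabilityMeasure_map (μ := (m : Measure X)) hmg.aemeasurable
  refine ext_of_forall_integral_eq_of_IsFiniteMeasure fun f => ?_
  rw [integral_map hmg.aemeasurable f.continuous.aestronglyMeasurable]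
  have h1 := hlim f
  have h2 := hlim (f.compContinuous ⟨fun y => g +ᵥ y, continuous_const_vadd g⟩)
  have hdiff : Tendsto (fun n => ∫ y, f (g +ᵥ y) ∂μ n - ∫ y, f y ∂μ n) u (𝓝 0) := by
    have hb : Tendsto (fun n => (2 * ‖f‖) *
        ((({r | r ∈ D n ∧ r + g ∉ D n} : Set G).ncard : ℝ) / (D n).card)) u (𝓝 0) := by
      simpa using ((hF g).mono_left hu).const_mul (2 * ‖f‖)
    refine squeeze_zero_norm (fun n => ?_) hb
    have e1 := hint n (f.compContinuous ⟨fun y => g +ᵥ y, continuous_const_vadd g⟩)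
    simp only [BoundedContinuousFunction.compContinuous_apply, ContinuousMap.coe_mk] at e1
    rw [e1, hint, ← mul_sub]
    have e2 : ∑ r ∈ D n, f (g +ᵥ r +ᵥ x) = ∑ r ∈ (D n).image (· + g), f (r +ᵥ x) := by
      rw [Finset.sum_image fun a _ b _ h => add_right_cancel h]
      exact Finset.sum_congr rfl fun r _ => by rw [← add_vadd, add_comm]
    have e3 : ((D n).image (· + g) \ D n).card = ({r | r ∈ D n ∧ r + g ∉ D n} : Set G).ncard := by
      have : ({r | r ∈ D n ∧ r + g ∉ D n} : Set G) = ↑((D n).filter fun r => r + g ∉ D n) := by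
        ext; simp
      rw [this, Set.ncard_coe_finset,
        ← Finset.card_image_of_injective ((D n).filter fun r => r + g ∉ D n) (add_left_injective g)]
      congr 1
      ext r
      simp only [Finset.mem_sdiff, Finset.mem_image, Finset.mem_filter]
      constructor
      · rintro ⟨⟨a, ha, rfl⟩, h⟩; exact ⟨a, ⟨ha, h⟩, rfl⟩
      · rintro ⟨a, ⟨ha, h⟩, rfl⟩; exact ⟨⟨a, ha, rfl⟩, h⟩
    have e4 : (D n \ (D n).image (· + g)).card = ((D n).image (· + g) \ D n).card :=
      Finset.card_sdiff_comm (Finset.card_image_of_injective _ (add_left_injective g)).symm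
    have hsum : ∀ s : Finset G, ‖∑ r ∈ s, f (r +ᵥ x)‖ ≤ s.card * ‖f‖ := fun s => by
      refine (norm_sum_le _ _).trans ?_
      simpa using Finset.sum_le_card_nsmul s _ ‖f‖ fun r _ => f.norm_coe_le_norm (r +ᵥ x)
    rw [e2, ← Finset.sum_sdiff_sub_sum_sdiff, norm_mul, norm_inv, Real.norm_natCast]
    have hs1 := hsum ((D n).image (· + g) \ D n)
    have hs2 := hsum (D n \ (D n).image (· + g))
    rw [e4, e3] at hs2
    rw [e3] at hs1
    calc _ ≤ ((D n).card : ℝ)⁻¹ * (2 * ‖f‖ * ({r | r ∈ D n ∧ r + g ∉ D n} : Set G).ncard) := by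
          gcongr
          refine (norm_sub_le _ _).trans ?_
          linarith
      _ = _ := by rw [div_eq_mul_inv]; ring
  exact sub_eq_zero.1 (tendsto_nhds_unique (h2.sub h1) hdiff)

namespace Tower

variable {G : Type*} [AddCommGroup G] (T : Tower G)

/-- Most points of the tile `D n` stay in it under translation by the elements of a finite set. -/
lemma tendsto_boundary (K : Finset G) :
    Tendsto (fun n => (({r | r ∈ T.D n ∧ ∃ h ∈ K, r + h ∉ T.D n} : Set G).ncard : ℝ) /
      (T.D n).card) atTop (𝓝 0) := by
  have h := tendsto_finsetSum K fun g _ => T.foelner g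
  rw [Finset.sum_const_zero] at h
  refine squeeze_zero (fun n => by positivity) (fun n => ?_) h
  rw [← Finset.sum_div]
  gcongr
  have e : ({r | r ∈ T.D n ∧ ∃ h ∈ K, r + h ∉ T.D n} : Set G) =
      ⋃ h ∈ K, {r | r ∈ T.D n ∧ r + h ∉ T.D n} := by
    ext; simp
  rw [e]
  exact_mod_cast Finset.set_ncard_biUnion_le K _

end Tower

namespace BlockScheme

variable {G A : Type*} [AddCommGroup G] (T : BlockScheme G A)
variable [TopologicalSpace A] [DiscreteTopology A]

lemma isMinimal [Finite A] : AddAction.IsMinimal G (orbitClosure T.point).carrier := by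
  refine ⟨fun y => ?_⟩
  let x : (orbitClosure T.point).carrier := ⟨T.point, mem_orbitClosure_self _⟩
  have hx : Dense (Set.range fun g : G => g +ᵥ x) := by
    rw [Subtype.dense_iff]
    refine closure_mono ?_
    rintro _ ⟨g, rfl⟩
    exact ⟨g +ᵥ x, ⟨g, rfl⟩, rfl⟩
  rw [dense_iff_inter_open]
  intro U hU hne
  obtain ⟨_, hgU, g, rfl⟩ := hx.inter_open_nonempty U hU hne
  -- The arrays aligned to the tiles of level `n` shrink to the distinguished array.
  obtain ⟨n, hn⟩ := exists_subset_nhds_of_isCompact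
    (V := fun n => {y : (orbitClosure T.point).carrier | T.Aligned n y.1})
    (U := (fun y => g +ᵥ y) ⁻¹' U)
    (directed_of_isDirected_le fun n m h w hw => Aligned.mono h hw)
    (fun n => ((T.isClosed_aligned n).preimage continuous_subtype_val).isCompact) (by
      intro y hy
      simp only [Set.mem_iInter, Set.mem_ofPred_eq] at hy
      have : y = x := Subtype.ext (T.eq_point_of_aligned hy)
      rw [this]
      exact (hU.preimage (continuous_const_vadd g)).mem_nhds hgU)
  refine ⟨(g + -T.position n y) +ᵥ y, ?_, ⟨_, rfl⟩⟩
  rw [add_vadd]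
  exact hn (T.aligned_position n y)

/-- The arrays of the orbit closure which carry the block `b` on the tile `D n`. -/
def cell (n : ℕ) (b : G → A) : Set (orbitClosure T.point).carrier :=
  {y | T.Aligned n y.1 ∧ ∀ g ∈ T.D n, y.1 g = b g}

lemma isClosed_cell (n : ℕ) (b : G → A) : IsClosed (T.cell n b) := by
  have e : T.cell n b = {y | T.Aligned n y.1} ∩ ⋂ g ∈ T.D n, {y | y.1 g = b g} := by
    ext y; simp [cell]
  rw [e]
  refine ((T.isClosed_aligned n).preimage continuous_subtype_val).inter
    (isClosed_biInter fun g _ => ?_)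
  have hc : Continuous fun y : (orbitClosure T.point).carrier => y.1 g :=
    (continuous_apply g).comp continuous_subtype_val
  exact (isClosed_discrete {b g}).preimage hc

lemma block_ext {n : ℕ} {b c : G → A} (hb : b ∈ T.B n) (hc : c ∈ T.B n)
    (h : ∀ g ∈ T.D n, b g = c g) : b = c :=
  (T.tiling n).ext_of_periodic (T.periodic n b hb) (T.periodic n c hc) (zero_mem _)
    fun g hg => h g ((T.mem_D n g).2 hg)

lemma eq_of_mem_cell {n : ℕ} {r s : G} {b c : G → A} (hr : r ∈ T.D n) (hs : s ∈ T.D n)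
    (hb : b ∈ T.B n) (hc : c ∈ T.B n) {y : (orbitClosure T.point).carrier}
    (h : -r +ᵥ y ∈ T.cell n b) (h' : -s +ᵥ y ∈ T.cell n c) : r = s ∧ b = c := by
  have e : r = s := by
    rw [← (T.aligned_iff_position_eq hr).1 h.1, ← (T.aligned_iff_position_eq hs).1 h'.1]
  subst e
  exact ⟨rfl, T.block_ext hb hc fun g hg => (h.2 g hg).symm.trans (h'.2 g hg)⟩

lemma exists_mem_cell {n : ℕ} {y : (orbitClosure T.point).carrier} (h : T.Aligned n y.1) :
    ∃ b ∈ T.B n, y ∈ T.cell n b := by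
  obtain ⟨b, hb, hyb⟩ := h 0 (zero_mem _)
  exact ⟨b, hb, h, fun g hg => hyb g ((T.mem_D n g).1 hg)⟩

section Measure

variable [MeasurableSpace (orbitClosure T.point).carrier]
  [BorelSpace (orbitClosure T.point).carrier]
  (μ : Measure (orbitClosure T.point).carrier)
  [VAddInvariantMeasure G (orbitClosure T.point).carrier μ]

lemma measurableSet_preimage_vadd {s : Set (orbitClosure T.point).carrier} (hs : IsClosed s)
    (r : G) : MeasurableSet ((fun y => r +ᵥ y) ⁻¹' s) :=
  (hs.preimage (continuous_const_vadd r)).measurableSet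

lemma isClosed_setOf_aligned (n : ℕ) :
    IsClosed {y : (orbitClosure T.point).carrier | T.Aligned n y.1} :=
  (T.isClosed_aligned n).preimage continuous_subtype_val

/-- A set is the disjoint union of its parts with prescribed position of the origin. -/
lemma measure_eq_sum (n : ℕ) {s : Set (orbitClosure T.point).carrier} (hs : MeasurableSet s) :
    μ s = ∑ r ∈ T.D n, μ (s ∩ (fun y => -r +ᵥ y) ⁻¹' {y | T.Aligned n y.1}) := by
  rw [← measure_biUnion_finset]
  · congr 1
    ext y
    simp only [Set.mem_iUnion, Set.mem_inter_iff, exists_prop]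
    exact ⟨fun h => ⟨_, T.position_mem n y, h, T.aligned_position n y⟩, fun ⟨_, _, h, _⟩ => h⟩
  · intro r hr s hs hrs
    refine Set.disjoint_left.2 fun y hy hy' => hrs ?_
    rw [← (T.aligned_iff_position_eq hr).1 hy.2, ← (T.aligned_iff_position_eq hs).1 hy'.2]
  · exact fun r _ => hs.inter (T.measurableSet_preimage_vadd (T.isClosed_setOf_aligned n) _)

lemma measure_aligned [IsProbabilityMeasure μ] (n : ℕ) :
    μ {y | T.Aligned n y.1} = ((T.D n).card : ENNReal)⁻¹ := by
  have h := T.measure_eq_sum μ n MeasurableSet.univ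
  simp only [Set.univ_inter, measure_preimage_vadd μ, measure_univ,
    Finset.sum_const, nsmul_eq_mul] at h
  exact ENNReal.eq_inv_of_mul_eq_one_left ((mul_comm _ _).trans h.symm)

lemma sum_measure_cell (n : ℕ) :
    ∑ b ∈ T.B n, μ (T.cell n b) = μ {y | T.Aligned n y.1} := by
  rw [← measure_biUnion_finset]
  · congr 1
    ext y
    simp only [Set.mem_iUnion, exists_prop]
    exact ⟨fun ⟨_, _, h⟩ => h.1, fun h => T.exists_mem_cell h⟩
  · intro b hb c hc hbc
    refine Set.disjoint_left.2 fun y hy hy' => hbc ?_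
    exact T.block_ext hb hc fun g hg => (hy.2 g hg).symm.trans (hy'.2 g hg)
  · exact fun b _ => (T.isClosed_cell n b).measurableSet

/-- All blocks of level `n` have the same measure, since they occur equally often in each block of
level `n + 1`. -/
lemma measure_cell [IsProbabilityMeasure μ] {n : ℕ} {b : G → A} (hb : b ∈ T.B n) :
    μ (T.cell n b) = T.t n * ((T.D (n + 1)).card : ENNReal)⁻¹ := by
  classical
  let I : Finset (G × (G → A)) := (T.D (n + 1) ×ˢ T.B (n + 1)).filter fun p =>
    p.1 ∈ T.Γ n ∧ ∀ g, T.P n g = p.1 → p.2 g = b g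
  have hU : T.cell n b = ⋃ p ∈ I, (fun y => -p.1 +ᵥ y) ⁻¹' T.cell (n + 1) p.2 := by
    ext y
    simp only [Set.mem_iUnion, I, Finset.mem_filter, Finset.mem_product, exists_prop]
    constructor
    · intro hy
      have hp := T.aligned_position (n + 1) y
      have hpΓ : T.position (n + 1) y ∈ T.Γ n := by
        have := T.sub_mem_of_aligned n y.2 (c' := 0) hp.of_succ (by simpa using hy.1)
        simpa using this
      obtain ⟨c, hc, hyc⟩ := T.exists_mem_cell (y := -T.position (n + 1) y +ᵥ y) hp
      refine ⟨(T.position (n + 1) y, c), ⟨⟨T.position_mem _ y, hc⟩, hpΓ, fun g hg => ?_⟩, hyc⟩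
      have hg' : g - T.position (n + 1) y ∈ T.D n := by
        rw [T.mem_D, sub_eq_add_neg, T.P_add n _ _ (neg_mem hpΓ), hg, add_neg_cancel]
      have hgD : g ∈ T.D (n + 1) := by
        rw [T.mem_D, ← T.P_succ, hg, (T.mem_D _ _).1 (T.position_mem (n + 1) y)]
      have h1 := hyc.2 g hgD
      have h2 := hy.2 _ hg'
      refine h1.symm.trans (Eq.trans ?_ (h2.trans ?_))
      · exact congrArg y.1 (neg_add_eq_sub _ _)
      · rw [sub_eq_add_neg, T.periodic n b hb _ _ (neg_mem hpΓ)]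
    · rintro ⟨⟨e, c⟩, ⟨⟨he, hc⟩, heΓ, hcb⟩, hy⟩
      simp only [Set.mem_preimage] at hy he hc heΓ hcb
      have e1 : y.1 = shift e (-e +ᵥ y).1 := by
        change _ = shift e (shift (-e) y.1)
        rw [← shift_add, neg_add_cancel, shift_zero]
      refine ⟨by rw [e1]; exact hy.1.of_succ.shift heΓ, fun g hg => ?_⟩
      have hg0 := (T.mem_D n g).1 hg
      have hP : T.P n (e + g) = e := by rw [T.P_add_left n g heΓ, hg0, add_zero]
      rw [e1, shift_apply, hy.2 _ ((T.mem_D _ _).2 (by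
        rw [← T.P_succ, hP, (T.mem_D _ _).1 he])), hcb _ hP, T.periodic_left hb heΓ]
  rw [hU, measure_biUnion_finset]
  · simp only [measure_preimage_vadd μ]
    simp only [I, Finset.sum_filter]
    rw [Finset.sum_product_right, ← T.measure_aligned μ (n + 1), ← T.sum_measure_cell μ (n + 1),
      Finset.mul_sum]
    refine Finset.sum_congr rfl fun c hc => ?_
    dsimp only
    rw [← Finset.sum_filter, Finset.sum_const, nsmul_eq_mul, ← (T.step n).count c hc b hb,
      ← Set.ncard_coe_finset]
    congr 3
    ext e
    simp
  · rintro ⟨e, c⟩ hp ⟨e', c'⟩ hp' hne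
    simp only [I, Finset.coe_filter, Finset.mem_product, Set.mem_ofPred_eq] at hp hp'
    refine Set.disjoint_left.2 fun y hy hy' => hne ?_
    obtain ⟨rfl, rfl⟩ := T.eq_of_mem_cell hp.1.1 hp'.1.1 hp.1.2 hp'.1.2 hy hy'
    rfl
  · exact fun p _ => T.measurableSet_preimage_vadd (T.isClosed_cell _ _) _

end Measure

/-- The cylinder of arrays agreeing with `p` on `K`. -/
def cylinderSet (K : Finset G) (p : G → A) : Set (orbitClosure T.point).carrier :=
  {y | ∀ h ∈ K, y.1 h = p h}

lemma isClosed_cylinderSet (K : Finset G) (p : G → A) : IsClosed (T.cylinderSet K p) := by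
  have e : T.cylinderSet K p = Subtype.val ⁻¹' (cylinder K p) := rfl
  rw [e]
  exact (isClosed_cylinder K p).preimage continuous_subtype_val

lemma isOpen_cylinderSet (K : Finset G) (p : G → A) : IsOpen (T.cylinderSet K p) := by
  have e : T.cylinderSet K p = Subtype.val ⁻¹' (cylinder K p) := rfl
  rw [e]
  exact (isOpen_cylinder K p).preimage continuous_subtype_val

section Unique

variable [MeasurableSpace (orbitClosure T.point).carrier]
  [BorelSpace (orbitClosure T.point).carrier]
  (μ ν : Measure (orbitClosure T.point).carrier)
  [VAddInvariantMeasure G (orbitClosure T.point).carrier μ] [IsProbabilityMeasure μ]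
  [VAddInvariantMeasure G (orbitClosure T.point).carrier ν] [IsProbabilityMeasure ν]

/-- If the window `K`, seen from the position `r`, lies inside the tile, then the measure of the
arrays in a cylinder over `K` with the origin at position `r` is the same for all invariant
measures. -/
lemma measure_cylinderSet_inter (n : ℕ) (K : Finset G) (p : G → A) {r : G}
    (hr : r ∈ T.D n) (hK : ∀ h ∈ K, r + h ∈ T.D n) :
    μ (T.cylinderSet K p ∩ (fun y => -r +ᵥ y) ⁻¹' {y | T.Aligned n y.1}) =
      ν (T.cylinderSet K p ∩ (fun y => -r +ᵥ y) ⁻¹' {y | T.Aligned n y.1}) := by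
  classical
  have hU : T.cylinderSet K p ∩ (fun y => -r +ᵥ y) ⁻¹' {y | T.Aligned n y.1} =
      ⋃ b ∈ (T.B n).filter fun b => ∀ h ∈ K, b (r + h) = p h,
        (fun y => -r +ᵥ y) ⁻¹' T.cell n b := by
    have hval : ∀ (y : (orbitClosure T.point).carrier) h, y.1 h = (-r +ᵥ y).1 (r + h) := by
      intro y h
      change y.1 h = y.1 (-r + (r + h))
      rw [neg_add_cancel_left]
    ext y
    simp only [Set.mem_iUnion, Finset.mem_filter, exists_prop, Set.mem_inter_iff]
    constructor
    · rintro ⟨hy, hya⟩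
      obtain ⟨b, hb, hyb⟩ := T.exists_mem_cell (y := -r +ᵥ y) hya
      refine ⟨b, ⟨hb, fun h hh => ?_⟩, hyb⟩
      rw [← hyb.2 _ (hK h hh), ← hval, hy h hh]
    · rintro ⟨b, ⟨hb, hbp⟩, hyb⟩
      refine ⟨fun h hh => ?_, hyb.1⟩
      rw [hval, hyb.2 _ (hK h hh), hbp h hh]
  have hm : ∀ (ρ : Measure (orbitClosure T.point).carrier)
      [VAddInvariantMeasure G (orbitClosure T.point).carrier ρ] [IsProbabilityMeasure ρ],
      ρ (⋃ b ∈ (T.B n).filter fun b => ∀ h ∈ K, b (r + h) = p h,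
        (fun y => -r +ᵥ y) ⁻¹' T.cell n b) =
      ∑ b ∈ (T.B n).filter fun b => ∀ h ∈ K, b (r + h) = p h,
        (T.t n * ((T.D (n + 1)).card : ENNReal)⁻¹) := by
    intro ρ _ _
    rw [measure_biUnion_finset]
    · refine Finset.sum_congr rfl fun b hb => ?_
      rw [measure_preimage_vadd ρ, T.measure_cell ρ (Finset.mem_filter.1 hb).1]
    · intro b hb c hc hbc
      refine Set.disjoint_left.2 fun y hy hy' => hbc ?_
      exact (T.eq_of_mem_cell hr hr (Finset.mem_filter.1 hb).1 (Finset.mem_filter.1 hc).1 hy hy').2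
    · exact fun b _ => T.measurableSet_preimage_vadd (T.isClosed_cell _ _) _
  rw [hU, hm, hm]

lemma measure_cylinderSet_le (K : Finset G) (p : G → A) :
    μ (T.cylinderSet K p) ≤ ν (T.cylinderSet K p) := by
  classical
  have hlim : Tendsto (fun n => ν (T.cylinderSet K p) + ENNReal.ofReal
      ((({r | r ∈ T.D n ∧ ∃ h ∈ K, r + h ∉ T.D n} : Set G).ncard : ℝ) / (T.D n).card))
      atTop (𝓝 (ν (T.cylinderSet K p))) := by
    have := (ENNReal.continuous_ofReal.tendsto 0).comp (T.tendsto_boundary K)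
    simpa using this.const_add (ν (T.cylinderSet K p))
  refine ge_of_tendsto' hlim fun n => ?_
  have hcl := (T.isClosed_cylinderSet K p).measurableSet
  rw [T.measure_eq_sum μ n hcl, T.measure_eq_sum ν n hcl]
  have hset : ({r | r ∈ T.D n ∧ ∃ h ∈ K, r + h ∉ T.D n} : Set G) =
      ↑((T.D n).filter fun r => ∃ h ∈ K, r + h ∉ T.D n) := by ext; simp
  have hbad : ENNReal.ofReal
      ((({r | r ∈ T.D n ∧ ∃ h ∈ K, r + h ∉ T.D n} : Set G).ncard : ℝ) / (T.D n).card) =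
      ∑ r ∈ T.D n, if ∃ h ∈ K, r + h ∉ T.D n then ((T.D n).card : ENNReal)⁻¹ else 0 := by
    rw [← Finset.sum_filter, Finset.sum_const, nsmul_eq_mul, hset, Set.ncard_coe_finset,
      ENNReal.ofReal_div_of_pos (by exact_mod_cast T.D_card_pos n), ENNReal.ofReal_natCast,
      ENNReal.ofReal_natCast, div_eq_mul_inv]
  rw [hbad, ← Finset.sum_add_distrib]
  refine Finset.sum_le_sum fun r hr => ?_
  split_ifs with hb
  · refine le_trans (measure_mono Set.inter_subset_right) ?_
    rw [measure_preimage_vadd μ, T.measure_aligned μ n]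
    exact le_add_self
  · push Not at hb
    rw [T.measure_cylinderSet_inter μ ν n K p hr hb, add_zero]

/-- Invariant probability measures agree on cylinders, hence are equal. -/
lemma invariant_measure_unique [Countable G] [Finite A] : μ = ν := by
  have hbasis : TopologicalSpace.IsTopologicalBasis
      (Set.range fun q : Finset G × (G → A) => T.cylinderSet q.1 q.2) := by
    refine TopologicalSpace.isTopologicalBasis_of_isOpen_of_nhds ?_ ?_
    · rintro _ ⟨q, rfl⟩
      exact T.isOpen_cylinderSet _ _
    · rintro y U hy hU
      obtain ⟨V, hV, rfl⟩ := isOpen_induced_iff.1 hU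
      obtain ⟨K, u, hu, hKV⟩ := isOpen_pi_iff.1 hV y.1 hy
      refine ⟨_, ⟨(K, y.1), rfl⟩, fun h _ => rfl, fun z hz => hKV fun h hh => ?_⟩
      rw [hz h hh]
      exact (hu h hh).2
  refine ext_of_generate_finite _
    ((BorelSpace.measurable_eq).trans hbasis.borel_eq_generateFrom) ?_ ?_ ?_
  · classical
    rintro _ ⟨⟨K, p⟩, rfl⟩ _ ⟨⟨L, q⟩, rfl⟩ ⟨z, hz1, hz2⟩
    refine ⟨(K ∪ L, z.1), ?_⟩
    ext y
    simp only [Set.mem_inter_iff, cylinderSet, Set.mem_ofPred_eq, Finset.mem_union] at hz1 hz2 ⊢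
    constructor
    · intro h
      exact ⟨fun i hi => (h i (.inl hi)).trans (hz1 i hi),
        fun i hi => (h i (.inr hi)).trans (hz2 i hi)⟩
    · rintro ⟨h1, h2⟩ i (hi | hi)
      · exact (h1 i hi).trans (hz1 i hi).symm
      · exact (h2 i hi).trans (hz2 i hi).symm
  · rintro _ ⟨⟨K, p⟩, rfl⟩
    exact le_antisymm (T.measure_cylinderSet_le μ ν K p) (T.measure_cylinderSet_le ν μ K p)
  · simp

end Unique

lemma isStrictlyErgodic [Countable G] [Finite A] [MeasurableSpace (orbitClosure T.point).carrier]
    [BorelSpace (orbitClosure T.point).carrier] :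
    IsStrictlyErgodic G (orbitClosure T.point).carrier := by
  refine ⟨T.isMinimal, ?_⟩
  have : Nonempty (orbitClosure T.point).carrier := ⟨⟨T.point, mem_orbitClosure_self _⟩⟩
  obtain ⟨μ, hμ, hinv⟩ := exists_invariant_probabilityMeasure
    (X := (orbitClosure T.point).carrier) T.D T.D_card_pos T.foelner
  refine ⟨μ, ⟨hμ, hinv⟩, ?_⟩
  rintro ν ⟨hν, hνinv⟩
  exact T.invariant_measure_unique ν μ

end BlockScheme

/-! ### Shearer's inequality -/

section Shearer

/-- A form of Hölder's inequality for `k` families, deduced from the inequality between the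
arithmetic and the geometric mean. -/
lemma sum_pow_le_of_pow_le_prod {α κ : Type*} {I : Finset α} {J : Finset κ} (hJ : 0 < J.card)
    {w : κ → α → ℝ} (hw : ∀ j a, 0 ≤ w j a) (hpos : ∀ j ∈ J, 0 < ∑ a ∈ I, w j a)
    {z : α → ℝ} (hz : ∀ a, 0 ≤ z a) {C : ℝ} (hC : 0 < C)
    (h : ∀ a ∈ I, z a ^ J.card ≤ C * ∏ j ∈ J, w j a) :
    (∑ a ∈ I, z a) ^ J.card ≤ C * ∏ j ∈ J, ∑ a ∈ I, w j a := by
  set c : κ → ℝ := fun j => ∑ a ∈ I, w j a with hc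
  set k := J.card with hk
  have hk0 : (k : ℝ) ≠ 0 := by exact_mod_cast hJ.ne'
  have hR : 0 < C * ∏ j ∈ J, c j := mul_pos hC (Finset.prod_pos hpos)
  set R : ℝ := (C * ∏ j ∈ J, c j) ^ (k : ℝ)⁻¹ with hRdef
  have hRpos : 0 < R := Real.rpow_pos_of_pos hR _
  have hRk : R ^ k = C * ∏ j ∈ J, c j := Real.rpow_inv_natCast_pow hR.le hJ.ne'
  have key : ∀ a ∈ I, z a / R ≤ ∑ j ∈ J, (k : ℝ)⁻¹ * (w j a / c j) := by
    intro a ha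
    have hq : ∀ j ∈ J, 0 ≤ w j a / c j := fun j hj => div_nonneg (hw j a) (hpos j hj).le
    refine le_trans ?_ (Real.geom_mean_le_arith_mean_weighted J (fun _ => (k : ℝ)⁻¹)
      (fun j => w j a / c j) (fun _ _ => by positivity) (by simp [← hk, hk0]) hq)
    rw [Real.finsetProd_rpow J _ hq]
    have hP : 0 ≤ ∏ j ∈ J, w j a / c j := Finset.prod_nonneg hq
    refine le_of_pow_le_pow_left₀ hJ.ne' (Real.rpow_nonneg hP _) ?_
    rw [Real.rpow_inv_natCast_pow hP hJ.ne', div_pow, hRk, Finset.prod_div_distrib,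
      div_le_div_iff₀ hR (Finset.prod_pos hpos)]
    calc z a ^ k * ∏ j ∈ J, c j ≤ (C * ∏ j ∈ J, w j a) * ∏ j ∈ J, c j :=
          mul_le_mul_of_nonneg_right (h a ha) (Finset.prod_pos hpos).le
      _ = _ := by ring
  have hsum : (∑ a ∈ I, z a) / R ≤ 1 := by
    rw [Finset.sum_div]
    refine (Finset.sum_le_sum key).trans ?_
    rw [Finset.sum_comm]
    have : ∀ j ∈ J, ∑ a ∈ I, (k : ℝ)⁻¹ * (w j a / c j) = (k : ℝ)⁻¹ := by
      intro j hj
      rw [← Finset.mul_sum, ← Finset.sum_div, div_self (hpos j hj).ne', mul_one]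
    rw [Finset.sum_congr rfl this]
    simp [← hk, hk0]
  rw [div_le_one hRpos] at hsum
  rw [← hRk]
  exact pow_le_pow_left₀ (Finset.sum_nonneg fun a _ => hz a) hsum k

open scoped Classical

variable {ι α : Type*}

/-- The restriction of `f` to the finite set `S`, extended by `none`. -/
noncomputable def mask (S : Finset ι) (f : ι → α) (i : ι) : Option α :=
  if i ∈ S then some (f i) else none

lemma mask_eq_iff {S : Finset ι} {f g : ι → α} : mask S f = mask S g ↔ ∀ i ∈ S, f i = g i := by
  simp only [funext_iff, mask]
  refine forall_congr' fun i => ?_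
  split_ifs with h <;> simp [h]

/-- The number of restrictions to `S` of the elements of `A`. -/
noncomputable def projCard (A : Finset (ι → α)) (S : Finset ι) : ℕ := (A.image (mask S)).card

lemma projCard_pos {A : Finset (ι → α)} (hA : A.Nonempty) (S : Finset ι) : 0 < projCard A S :=
  Finset.card_pos.2 (hA.image _)

lemma projCard_mono_left {A A' : Finset (ι → α)} (h : A ⊆ A') (S : Finset ι) :
    projCard A S ≤ projCard A' S := Finset.card_le_card (Finset.image_subset_image h)

lemma projCard_insert (A : Finset (ι → α)) {S : Finset ι} {i : ι} (hi : i ∉ S) :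
    projCard A (insert i S) = ∑ a ∈ A.image (fun f => f i),
      projCard (A.filter fun f => f i = a) S := by
  unfold projCard
  rw [Finset.card_eq_sum_card_fiberwise (f := fun m => m i)
    (t := (A.image (fun f => f i)).image some)]
  · rw [Finset.sum_image fun a _ b _ h => Option.some_injective _ h]
    refine Finset.sum_congr rfl fun a _ => ?_
    have : ((A.image (mask (insert i S))).filter fun m => m i = some a) =
        ((A.filter fun f => f i = a).image (mask S)).image
          (fun m => Function.update m i (some a)) := by
      ext m
      simp only [Finset.mem_filter, Finset.mem_image]
      have hm : ∀ f : ι → α, mask (insert i S) f = Function.update (mask S f) i (some (f i)) := by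
        intro f
        funext l
        by_cases hl : l = i
        · subst hl; simp [mask]
        · simp [mask, hl]
      constructor
      · rintro ⟨⟨f, hf, rfl⟩, hfa⟩
        rw [hm, Function.update_self] at hfa
        refine ⟨mask S f, ⟨f, ⟨hf, Option.some_injective _ hfa⟩, rfl⟩, ?_⟩
        rw [hm, hfa]
      · rintro ⟨_, ⟨f, ⟨hf, hfa⟩, rfl⟩, rfl⟩
        exact ⟨⟨f, hf, by rw [hm, hfa]⟩, by simp⟩
    rw [this, Finset.card_image_of_injOn]
    intro m hm m' hm' h
    simp only [Finset.coe_image, Set.mem_image] at hm hm'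
    obtain ⟨f, -, rfl⟩ := hm
    obtain ⟨f', -, rfl⟩ := hm'
    funext l
    by_cases hl : l = i
    · subst hl; simp [mask, hi]
    · have := congrFun h l
      simpa [Function.update_of_ne hl] using this
  · intro m hm
    simp only [Finset.coe_image, Set.mem_image] at hm ⊢
    obtain ⟨f, hf, rfl⟩ := hm
    exact ⟨f i, ⟨f, hf, rfl⟩, by simp [mask]⟩

/-- Shearer's inequality: if each point of `U` lies in at least `k` of the sets `S j`, then the
`k`-th power of the number of restrictions to `U` is at most the product of the numbers of
restrictions to the sets `S j ∩ U`. -/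
lemma projCard_pow_le {κ : Type*} {k : ℕ} (hk : 0 < k) (J : Finset κ)
    (S : κ → Finset ι)
    (U : Finset ι) (hU : ∀ i ∈ U, k ≤ (J.filter fun j => i ∈ S j).card) :
    ∀ {A : Finset (ι → α)}, A.Nonempty → projCard A U ^ k ≤ ∏ j ∈ J, projCard A (S j ∩ U) := by
  induction U using Finset.induction_on with
  | empty =>
    intro A hA
    have : projCard A ∅ = 1 := by
      rw [projCard, Finset.card_eq_one]
      refine ⟨fun _ => none, ?_⟩
      have : ∀ f : ι → α, mask ∅ f = fun _ => none := fun f => by funext; simp [mask]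
      rw [funext this, Finset.image_const hA]
    simp [this]
  | insert i U hi ih =>
    intro A hA
    obtain ⟨J₁, hJ₁, hcard⟩ := Finset.exists_subset_card_eq (hU i (Finset.mem_insert_self i U))
    have hJ : ∀ j ∈ J₁, j ∈ J ∧ i ∈ S j := fun j hj => Finset.mem_filter.1 (hJ₁ hj)
    have hJsub : J₁ ⊆ J := fun j hj => (hJ j hj).1
    set I := A.image (fun f => f i)
    let Aa : α → Finset (ι → α) := fun a => A.filter fun f => f i = a
    have hAa : ∀ a ∈ I, (Aa a).Nonempty := by
      intro a ha
      obtain ⟨f, hf, rfl⟩ := Finset.mem_image.1 ha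
      exact ⟨f, Finset.mem_filter.2 ⟨hf, rfl⟩⟩
    have hsplit : ∀ j, i ∈ S j → projCard A (S j ∩ insert i U) =
        ∑ a ∈ I, projCard (Aa a) (S j ∩ U) := by
      intro j hj
      rw [Finset.inter_insert_of_mem hj, projCard_insert A (by simp [hi])]
    have hle : ∀ j, ∀ a ∈ I, projCard (Aa a) (S j ∩ U) ≤ projCard A (S j ∩ insert i U) := by
      intro j a ha
      by_cases hj : i ∈ S j
      · rw [hsplit j hj]
        exact Finset.single_le_sum (f := fun a => projCard (Aa a) (S j ∩ U))
          (fun _ _ => Nat.zero_le _) ha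
      · rw [Finset.inter_insert_of_notMem hj]
        exact projCard_mono_left (Finset.filter_subset _ _) _
    have hmain := sum_pow_le_of_pow_le_prod (I := I) (J := J₁)
      (w := fun j a => (projCard (Aa a) (S j ∩ U) : ℝ)) (z := fun a => (projCard (Aa a) U : ℝ))
      (C := ∏ j ∈ J \ J₁, (projCard A (S j ∩ insert i U) : ℝ)) (by omega)
      (fun _ _ => Nat.cast_nonneg _) (fun j hj => by
        have := projCard_pos hA (S j ∩ insert i U)
        rw [hsplit j (hJ j hj).2] at this
        exact_mod_cast this) (fun _ => Nat.cast_nonneg _)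
      (Finset.prod_pos fun j _ => by exact_mod_cast projCard_pos hA _) (fun a ha => by
        rw [hcard]
        have h1 := ih (fun l hl => hU l (Finset.mem_insert_of_mem hl)) (hAa a ha)
        rw [← Finset.prod_sdiff hJsub] at h1
        have h2 : ∏ j ∈ J \ J₁, projCard (Aa a) (S j ∩ U) ≤
            ∏ j ∈ J \ J₁, projCard A (S j ∩ insert i U) :=
              Finset.prod_le_prod' fun j _ => hle j a ha
        exact_mod_cast h1.trans (Nat.mul_le_mul_right _ h2))
    rw [projCard_insert A hi, ← Finset.prod_sdiff hJsub,
      Finset.prod_congr rfl fun j (hj : j ∈ J₁) => hsplit j (hJ j hj).2]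
    rw [hcard] at hmain
    exact_mod_cast hmain

end Shearer

/-! ### Entropy -/

open scoped Pointwise in
/-- A Følner sequence is almost invariant under thickening by a finite set. -/
lemma IsAddFoelner.tendsto_card_add {G : Type*} [AddCommGroup G] [DecidableEq G] [MeasurableSpace G]
    [MeasurableSingletonClass G] {F : ℕ → Finset G}
    (hF : IsAddFoelner G (Measure.count : Measure G) atTop (fun n => (F n : Set G)))
    {K : Finset G} (hK : 0 ∈ K) :
    Tendsto (fun n => ((F n + K).card : ℝ) / (F n).card) atTop (𝓝 1) := by
  have hne : ∀ᶠ n in atTop, 0 < (F n).card := by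
    filter_upwards [hF.eventually_meas_ne_zero] with n hn
    rw [Finset.card_pos, Finset.nonempty_iff_ne_empty]
    rintro h
    simp [h] at hn
  have hg : ∀ g : G, Tendsto (fun n => ((((F n).image (g + ·)) \ F n).card : ℝ) / (F n).card)
      atTop (𝓝 0) := by
    intro g
    have h1 := (ENNReal.tendsto_toReal ENNReal.zero_ne_top).comp (hF.tendsto_meas_vadd_symmDiff g)
    rw [ENNReal.toReal_zero] at h1
    refine squeeze_zero (fun n => by positivity) (fun n => ?_) h1
    simp only [Function.comp_apply, ENNReal.toReal_div, Measure.count_apply_finset]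
    rw [ENNReal.toReal_natCast]
    gcongr
    have e : (g +ᵥ (F n : Set G)) = ((F n).image (g + ·) : Finset G) := by
      ext; simp only [Set.mem_vadd_set, Finset.coe_image, Set.mem_image, vadd_eq_add]
    rw [e, ← Finset.coe_symmDiff, Measure.count_apply_finset, ENNReal.toReal_natCast]
    exact_mod_cast Finset.card_le_card fun x hx => by
      rw [Finset.mem_symmDiff]; exact .inl (Finset.mem_sdiff.1 hx)
  have hsum := tendsto_finsetSum K fun g _ => hg g
  rw [Finset.sum_const_zero] at hsum
  have hup : Tendsto (fun n => 1 + ∑ g ∈ K, ((((F n).image (g + ·)) \ F n).card : ℝ) / (F n).card)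
      atTop (𝓝 1) := by simpa using hsum.const_add 1
  refine tendsto_of_tendsto_of_tendsto_of_le_of_le' tendsto_const_nhds hup ?_ ?_
  · filter_upwards [hne] with n hn
    rw [le_div_iff₀ (by exact_mod_cast hn), one_mul]
    exact_mod_cast Finset.card_le_card (Finset.subset_add_left _ hK)
  · filter_upwards [hne] with n hn
    rw [← Finset.sum_div, div_le_iff₀ (by exact_mod_cast hn), add_mul, one_mul,
      div_mul_cancel₀ _ (by exact_mod_cast hn.ne')]
    have hsub : F n + K ⊆ F n ∪ K.biUnion fun g => ((F n).image (g + ·)) \ F n := by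
      intro x hx
      obtain ⟨f, hf, g, hgK, rfl⟩ := Finset.mem_add.1 hx
      by_cases hx : f + g ∈ F n
      · exact Finset.mem_union_left _ hx
      · refine Finset.mem_union_right _ (Finset.mem_biUnion.2 ⟨g, hgK, ?_⟩)
        exact Finset.mem_sdiff.2 ⟨Finset.mem_image.2 ⟨f, hf, add_comm _ _⟩, hx⟩
    exact_mod_cast (Finset.card_le_card hsub).trans
      ((Finset.card_union_le _ _).trans (Nat.add_le_add_left Finset.card_biUnion_le _))

open scoped Pointwise in
lemma IsAddFoelner.tendsto_card {G : Type*} [AddCommGroup G] [Infinite G] [MeasurableSpace G]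
    [MeasurableSingletonClass G] {F : ℕ → Finset G}
    (hF : IsAddFoelner G (Measure.count : Measure G) atTop (fun n => (F n : Set G))) :
    Tendsto (fun n => ((F n).card : ℝ)) atTop atTop := by
  classical
  rw [tendsto_atTop]
  intro b
  obtain ⟨m, hm⟩ := exists_nat_gt (2 * b)
  obtain ⟨K, hK⟩ := Infinite.exists_subset_card_eq G m
  have h := hF.tendsto_card_add (Finset.mem_insert_self 0 K)
  have hne : ∀ᶠ n in atTop, 0 < (F n).card := by
    filter_upwards [hF.eventually_meas_ne_zero] with n hn
    rw [Finset.card_pos, Finset.nonempty_iff_ne_empty]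
    rintro h
    simp [h] at hn
  filter_upwards [h.eventually (gt_mem_nhds (by norm_num : (1 : ℝ) < 2)), hne] with n h2 hn
  rw [div_lt_iff₀ (by exact_mod_cast hn)] at h2
  have h3 : m ≤ (F n + insert 0 K).card := by
    rw [← hK]
    exact (Finset.card_le_card (Finset.subset_insert 0 K)).trans
      (Finset.card_le_card_add_left (Finset.card_pos.1 hn))
  have h4 : (m : ℝ) ≤ (F n + insert 0 K).card := by exact_mod_cast h3
  linarith

open scoped Pointwise in
/-- A sequence of finite sets most of whose points stay inside under translations is Følner. -/
lemma isAddFoelner_of_tendsto {G : Type*} [AddCommGroup G] [MeasurableSpace G]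
    [MeasurableSingletonClass G] {D : ℕ → Finset G} (hD : ∀ n, 0 < (D n).card)
    (h : ∀ g, Tendsto (fun n => (({r | r ∈ D n ∧ r + g ∉ D n} : Set G).ncard : ℝ) / (D n).card)
      atTop (𝓝 0)) :
    IsAddFoelner G (Measure.count : Measure G) atTop (fun n => (D n : Set G)) := by
  classical
  refine ⟨.of_forall fun n => (D n).measurableSet, .of_forall fun n => ?_,
    .of_forall fun n => ?_, fun g => ?_⟩
  · rw [Measure.count_apply_finset]; exact_mod_cast (hD n).ne'
  · rw [Measure.count_apply_finset]; simp
  · have h1 := (h g).add (h (-g))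
    rw [add_zero] at h1
    have h2 := (ENNReal.continuous_ofReal.tendsto 0).comp h1
    rw [ENNReal.ofReal_zero] at h2
    refine tendsto_of_tendsto_of_tendsto_of_le_of_le tendsto_const_nhds h2 (fun _ => zero_le)
      fun n => ?_
    have e : (g +ᵥ (D n : Set G)) = ((D n).image (g + ·) : Finset G) := by
      ext; simp only [Set.mem_vadd_set, Finset.coe_image, Set.mem_image, vadd_eq_add]
    have e' : ∀ g, ({r | r ∈ D n ∧ r + g ∉ D n} : Set G) =
        ((D n).filter fun r => r + g ∉ D n : Finset G) := fun g => by ext; simp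
    simp only [Function.comp_apply]
    rw [e, ← Finset.coe_symmDiff, Measure.count_apply_finset, Measure.count_apply_finset,
      ← add_div, ENNReal.ofReal_div_of_pos (by exact_mod_cast hD n), ENNReal.ofReal_natCast,
      e', e', Set.ncard_coe_finset, Set.ncard_coe_finset, ← Nat.cast_add, ENNReal.ofReal_natCast]
    gcongr
    have hsub : symmDiff ((D n).image (g + ·)) (D n) ⊆
        ((D n).filter fun r => r + g ∉ D n).image (g + ·) ∪
          ((D n).filter fun r => r + -g ∉ D n) := by
      intro x hx
      rw [Finset.mem_symmDiff] at hx
      rcases hx with ⟨hx, hx'⟩ | ⟨hx, hx'⟩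
      · obtain ⟨a, ha, rfl⟩ := Finset.mem_image.1 hx
        refine Finset.mem_union_left _ (Finset.mem_image_of_mem _ (Finset.mem_filter.2 ⟨ha, ?_⟩))
        rwa [add_comm]
      · refine Finset.mem_union_right _ (Finset.mem_filter.2 ⟨hx, fun h => hx' ?_⟩)
        exact Finset.mem_image.2 ⟨_, h, by abel⟩
    exact (Finset.card_le_card hsub).trans ((Finset.card_union_le _ _).trans
      (Nat.add_le_add_right Finset.card_image_le _))

namespace BlockScheme

variable {G A : Type*} [AddCommGroup G] (T : BlockScheme G A) [TopologicalSpace A]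
  [DiscreteTopology A] [Finite A]

lemma blockCount_pos {Y : Subshift A G} (hY : Y.carrier.Nonempty) (F : Finset G) :
    0 < blockCount Y F := by
  obtain ⟨y, hy⟩ := hY
  exact (Set.ncard_pos (Set.toFinite _)).2 ⟨fun m => y m, y, hy, fun _ => rfl⟩

open scoped Classical Pointwise in
/-- A pattern on `F` is determined by the position of the origin in its tile and by the blocks of
level `n` on the tiles meeting the corresponding translate of `F`. -/
lemma log_blockCount_le (n : ℕ) (F : Finset G) :
    Real.log (blockCount (orbitClosure T.point) F) ≤ Real.log (T.D n).card +
      ((F + (T.D n - T.D n)).card : ℝ) * (Real.log (T.B n).card / (T.D n).card) := by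
  let U : G → Finset G := fun r => F.image fun f => T.P n (r + f)
  -- The tiles meeting `r + F` are disjoint and contained in a thickening of `r + F`.
  have hU : ∀ r, (U r).card * (T.D n).card ≤ (F + (T.D n - T.D n)).card := by
    intro r
    rw [← Finset.card_product]
    refine Finset.card_le_card_of_injOn (fun p => p.1 + p.2 - r) ?_ ?_
    · rintro ⟨u, δ⟩ hp
      obtain ⟨hu, hδ⟩ := Finset.mem_product.1 hp
      obtain ⟨f, hf, rfl⟩ := Finset.mem_image.1 hu
      refine Finset.mem_coe.2 (Finset.mem_add.2 ⟨f, hf, δ - (r + f - T.P n (r + f)),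
        Finset.sub_mem_sub hδ (T.sub_P_mem_D n _), ?_⟩)
      dsimp only; abel
    · rintro ⟨u, δ⟩ hp ⟨u', δ'⟩ hp' h
      obtain ⟨hu, hδ⟩ := Finset.mem_product.1 hp
      obtain ⟨hu', hδ'⟩ := Finset.mem_product.1 hp'
      obtain ⟨f, -, hf⟩ := Finset.mem_image.1 hu
      obtain ⟨f', -, hf'⟩ := Finset.mem_image.1 hu'
      dsimp only at h hf hf' hδ hδ'
      have h1 : u + δ = u' + δ' := sub_left_injective h
      have h2 : u = u' := by
        have := congrArg (T.P n) h1
        rwa [T.P_add_left n _ (hf ▸ T.P_mem n _), T.P_add_left n _ (hf' ▸ T.P_mem n _),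
          (T.mem_D n _).1 hδ, (T.mem_D n _).1 hδ', add_zero, add_zero] at this
      subst h2
      rw [add_left_cancel h1]
  have hBpos : 0 < (T.B n).card := Finset.card_pos.2 ⟨_, T.a_mem n⟩
  have hDpos : 0 < (T.D n).card := T.D_card_pos n
  let Φ : (r : G) → (U r → T.B n) → (F → A) := fun r φ f =>
    (φ ⟨T.P n (r + f), Finset.mem_image_of_mem _ f.2⟩).1 (r + f)
  have hcover : {p : F → A | ∃ y ∈ (orbitClosure T.point).carrier, ∀ m : F, y m = p m} ⊆
      ⋃ r ∈ T.D n, Set.range (Φ r) := by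
    rintro p ⟨y, hy, hyp⟩
    obtain ⟨r, hr, hal⟩ := T.exists_aligned n hy
    choose b hb hyb using hal
    have hUΓ : ∀ u : U r, u.1 ∈ T.Γ n := fun u => by
      obtain ⟨f, -, hf⟩ := Finset.mem_image.1 u.2
      rw [← hf]
      exact T.P_mem n _
    refine Set.mem_biUnion (Finset.mem_coe.2 hr) ⟨fun u => ⟨b u.1 (hUΓ u), hb _ _⟩, ?_⟩
    funext f
    change b (T.P n (r + f)) _ (r + f) = p f
    rw [← hyb _ (T.P_mem n _) (r + f) rfl, shift_apply, neg_add_cancel_left, hyp]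
  have hcount : (blockCount (orbitClosure T.point) F : ℝ) ≤ (T.D n).card *
      ((T.B n).card : ℝ) ^ (((F + (T.D n - T.D n)).card : ℝ) / (T.D n).card) := by
    have h1 : blockCount (orbitClosure T.point) F ≤ ∑ r ∈ T.D n, (Set.range (Φ r)).ncard :=
      (Set.ncard_le_ncard hcover (Set.toFinite _)).trans (Finset.set_ncard_biUnion_le _ _)
    have h2 : ∀ r ∈ T.D n, ((Set.range (Φ r)).ncard : ℝ) ≤
        ((T.B n).card : ℝ) ^ (((F + (T.D n - T.D n)).card : ℝ) / (T.D n).card) := by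
      intro r _
      have h3 : (Set.range (Φ r)).ncard ≤ (T.B n).card ^ (U r).card := by
        rw [← Set.image_univ]
        refine (Set.ncard_image_le (Set.toFinite _)).trans ?_
        rw [Set.ncard_univ, Nat.card_fun]
        simp
      calc ((Set.range (Φ r)).ncard : ℝ) ≤ ((T.B n).card : ℝ) ^ ((U r).card : ℝ) := by
            rw [Real.rpow_natCast]; exact_mod_cast h3
        _ ≤ _ := by
            refine Real.rpow_le_rpow_of_exponent_le (by exact_mod_cast hBpos) ?_
            rw [le_div_iff₀ (by exact_mod_cast hDpos)]
            exact_mod_cast hU r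
    calc (blockCount (orbitClosure T.point) F : ℝ) ≤
          ∑ r ∈ T.D n, ((Set.range (Φ r)).ncard : ℝ) := by
          exact_mod_cast h1
      _ ≤ _ := by
          refine (Finset.sum_le_sum h2).trans ?_
          rw [Finset.sum_const, nsmul_eq_mul]
  have hpos := blockCount_pos (Y := orbitClosure T.point) ⟨_, mem_orbitClosure_self _⟩ F
  have hB' : (0 : ℝ) < (T.B n).card := by exact_mod_cast hBpos
  refine (Real.log_le_log (by exact_mod_cast hpos) hcount).trans ?_
  rw [Real.log_mul (by exact_mod_cast hDpos.ne') (Real.rpow_pos_of_pos hB' _).ne',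
    Real.log_rpow hB']
  exact le_of_eq (by ring)

lemma projCard_le_blockCount (n : ℕ) (F : Finset G) (g : G) {S : Finset G} (hS : S ⊆ T.D n)
    (hSF : ∀ i ∈ S, i - g ∈ F) :
    projCard (T.B n) S ≤ blockCount (orbitClosure T.point) F := by
  classical
  rw [projCard, ← Set.ncard_coe_finset, blockCount]
  let Φ : (F → A) → G → Option A := fun p i =>
    if h : i ∈ S then some (p ⟨i - g, hSF i h⟩) else none
  refine (Set.ncard_le_ncard (t := Φ '' {p : F → A | ∃ y ∈ (orbitClosure T.point).carrier,
    ∀ m : F, y m = p m}) ?_ (Set.toFinite _)).trans (Set.ncard_image_le (Set.toFinite _))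
  intro m hm
  obtain ⟨b, hb, rfl⟩ := Finset.mem_image.1 (Finset.mem_coe.1 hm)
  obtain ⟨u, hu, hub⟩ := (T.aligned_point (n + 1)).exists_occurrence hb
  refine ⟨fun f => shift (u + g) T.point f, ⟨shift (u + g) T.point, subset_closure ⟨_, rfl⟩,
    fun _ => rfl⟩, ?_⟩
  funext i
  simp only [Φ, mask]
  split_ifs with hi
  · have e : u + g + (i - g) = u + i := by abel
    rw [shift_apply, e, hub _ (by rw [T.P_add_left n i hu, (T.mem_D n i).1 (hS hi), add_zero]),
      T.periodic_left hb hu]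
  · rfl

open scoped Classical Pointwise in
/-- Shearer's inequality applied to the covering of the tile `D n` by the translates of `F`. -/
lemma card_mul_log_card_le (n : ℕ) {F : Finset G} (hF : F.Nonempty) :
    (F.card : ℝ) * Real.log (T.B n).card ≤
      ((T.D n - F).card : ℝ) * Real.log (blockCount (orbitClosure T.point) F) := by
  have hB : (T.B n).Nonempty := ⟨_, T.a_mem n⟩
  have hsh := projCard_pow_le (A := T.B n) (Finset.card_pos.2 hF) (T.D n - F)
    (fun g => F.image (· + g)) (T.D n) (fun i hi => by
      refine Finset.card_le_card_of_injOn (fun f => i - f) (fun f hf => ?_)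
        fun _ _ _ _ h => sub_right_injective h
      refine Finset.mem_coe.2 (Finset.mem_filter.2 ⟨Finset.sub_mem_sub hi hf, ?_⟩)
      exact Finset.mem_image.2 ⟨f, hf, add_sub_cancel f i⟩) hB
  have hcard : projCard (T.B n) (T.D n) = (T.B n).card := by
    rw [projCard, Finset.card_image_of_injOn]
    intro b hb c hc h
    exact T.block_ext hb hc (mask_eq_iff.1 h)
  have hprod : ∏ g ∈ T.D n - F, projCard (T.B n) (F.image (· + g) ∩ T.D n) ≤
      blockCount (orbitClosure T.point) F ^ (T.D n - F).card := by
    rw [← Finset.prod_const]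
    refine Finset.prod_le_prod' fun g _ => T.projCard_le_blockCount n F g
      Finset.inter_subset_right fun i hi => ?_
    obtain ⟨f, hf, rfl⟩ := Finset.mem_image.1 (Finset.mem_inter.1 hi).1
    rwa [add_sub_cancel_right]
  rw [hcard] at hsh
  have h1 : ((T.B n).card : ℝ) ^ F.card ≤
      (blockCount (orbitClosure T.point) F : ℝ) ^ (T.D n - F).card := by
    exact_mod_cast hsh.trans hprod
  have hB' : (0 : ℝ) < (T.B n).card := by exact_mod_cast Finset.card_pos.2 hB
  have := Real.log_le_log (pow_pos hB' _) h1
  rwa [Real.log_pow, Real.log_pow] at this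

open scoped Classical Pointwise in
lemma hasTopologicalEntropy [Infinite G] [MeasurableSpace G] [MeasurableSingletonClass G] {h : ℝ}
    (hlow : ∀ n, h * (T.D n).card ≤ Real.log (T.B n).card)
    (hlim : Tendsto (fun n => Real.log (T.B n).card / (T.D n).card) atTop (𝓝 h)) :
    HasTopologicalEntropy (orbitClosure T.point) h := by
  have hfoel := isAddFoelner_of_tendsto T.D_card_pos T.foelner
  refine ⟨⟨T.D, hfoel⟩, fun F hF => ?_⟩
  -- The lower bound holds for every nonempty finite set.
  have hlower : ∀ E : Finset G, E.Nonempty →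
      h * E.card ≤ Real.log (blockCount (orbitClosure T.point) E) := by
    intro E hE
    obtain ⟨e, he⟩ := hE
    have hK := hfoel.tendsto_card_add (K := insert 0 (-E)) (Finset.mem_insert_self _ _)
    have hlog : 0 ≤ Real.log (blockCount (orbitClosure T.point) E) := Real.log_natCast_nonneg _
    have h1 := hK.mul_const (Real.log (blockCount (orbitClosure T.point) E))
    rw [one_mul] at h1
    refine ge_of_tendsto' h1 fun n => ?_
    have hD : (0 : ℝ) < (T.D n).card := by exact_mod_cast T.D_card_pos n
    have h2 := T.card_mul_log_card_le n ⟨e, he⟩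
    have h3 : ((T.D n - E).card : ℝ) ≤ (T.D n + insert 0 (-E)).card := by
      rw [sub_eq_add_neg]
      exact_mod_cast Finset.card_le_card (Finset.add_subset_add_left (Finset.subset_insert _ _))
    have h4 := mul_le_mul_of_nonneg_right h3 hlog
    have h5 := mul_le_mul_of_nonneg_left (hlow n) (Nat.cast_nonneg (α := ℝ) E.card)
    rw [div_mul_eq_mul_div, le_div_iff₀ hD]
    linarith
  have hcardF := hF.tendsto_card
  have hev : ∀ᶠ n in atTop, (0 : ℝ) < (F n).card := hcardF.eventually_gt_atTop 0
  refine tendsto_order.2 ⟨fun c hc => ?_, fun c hc => ?_⟩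
  · filter_upwards [hev] with n hn
    refine hc.trans_le ?_
    rw [le_div_iff₀ hn]
    exact hlower _ (Finset.card_pos.1 (by exact_mod_cast hn))
  · obtain ⟨m, hm⟩ := (hlim.eventually (gt_mem_nhds hc)).exists
    have hmem : (0 : G) ∈ T.D m - T.D m :=
      Finset.mem_sub.2 ⟨0, T.zero_mem_D m, 0, T.zero_mem_D m, sub_zero 0⟩
    have h1 := (hF.tendsto_card_add hmem).mul_const (Real.log (T.B m).card / (T.D m).card)
    have h2 := hcardF.const_div_atTop (Real.log (T.D m).card)
    have h3 := h2.add h1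
    rw [zero_add, one_mul] at h3
    filter_upwards [h3.eventually (gt_mem_nhds hm), hev] with n hn hpos
    refine lt_of_le_of_lt ?_ hn
    rw [div_mul_eq_mul_div, ← add_div]
    gcongr
    exact T.log_blockCount_le m (F n)

end BlockScheme

/-! ### Counting equidistributed functions -/

section Equidistributed

open scoped Classical

variable {E Q : Type*} [Fintype E] [Fintype Q]

/-- The functions `E → Q` taking every value exactly `s` times. -/
noncomputable def equidistributed (E Q : Type*) [Fintype E] [Fintype Q] (s : ℕ) :
    Finset (E → Q) :=
  Finset.univ.filter fun f => ∀ b, (Finset.univ.filter fun e => f e = b).card = s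

lemma mem_equidistributed {s : ℕ} {f : E → Q} : f ∈ equidistributed E Q s ↔
    ∀ b, (Finset.univ.filter fun e => f e = b).card = s := by
  simp [equidistributed]

/-- Some fibre of a map between finite types is at least as large as the average. -/
lemma exists_card_le_mul_card_fiber {α β : Type*} [Fintype β] [Nonempty β] (S : Finset α)
    (f : α → β) : ∃ b, S.card ≤ Fintype.card β * (S.filter fun x => f x = b).card := by
  obtain ⟨b, -, hb⟩ := Finset.exists_max_image Finset.univ
    (fun b => (S.filter fun x => f x = b).card) Finset.univ_nonempty
  refine ⟨b, ?_⟩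
  rw [Finset.card_eq_sum_card_fiberwise (f := f) (t := Finset.univ)
    fun _ _ => Finset.mem_coe.2 (Finset.mem_univ _)]
  refine (Finset.sum_le_sum fun b' _ => hb b' (Finset.mem_univ _)).trans ?_
  simp

/-- There are many equidistributed functions. Choose the most frequent distribution of values among
the words of length `s`. Concatenating one word for each element `i` of the alphabet, all with this
distribution and the word of index `i` translated by `i` for a group structure on the alphabet,
gives an equidistributed word. -/
lemma pow_le_card_equidistributed [Nonempty Q] {s : ℕ}
    (hE : Fintype.card E = Fintype.card Q * s) :
    (Fintype.card Q ^ s) ^ Fintype.card Q ≤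
      ((s + 1) ^ Fintype.card Q) ^ Fintype.card Q * (equidistributed E Q s).card := by
  have : NeZero (Fintype.card Q) := ⟨Fintype.card_ne_zero⟩
  let φ : Q ≃ ZMod (Fintype.card Q) := Fintype.equivOfCardEq (by rw [ZMod.card])
  let : AddCommGroup Q := φ.addCommGroup
  let ε : E ≃ Q × Fin s := Fintype.equivOfCardEq (by simp [hE])
  let τ : (Fin s → Q) → Q → Fin (s + 1) := fun w b =>
    ⟨(Finset.univ.filter fun j => w j = b).card, Nat.lt_succ_of_le
      ((Finset.card_le_univ _).trans (by simp))⟩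
  obtain ⟨c, hc⟩ := exists_card_le_mul_card_fiber Finset.univ τ
  set C := Finset.univ.filter fun w => τ w = c with hC
  have h1 : Fintype.card Q ^ s ≤ (s + 1) ^ Fintype.card Q * C.card := by
    simp only [Finset.card_univ, Fintype.card_fun, Fintype.card_fin] at hc
    convert hc
  have hcount : ∀ w ∈ C, ∀ b, (Finset.univ.filter fun j => w j = b).card = (c b : ℕ) := by
    intro w hw b
    rw [hC, Finset.mem_filter] at hw
    rw [← hw.2]
  have h2 : C.card ^ Fintype.card Q ≤ (equidistributed E Q s).card := by
    have : (Fintype.piFinset fun _ : Q => C).card = C.card ^ Fintype.card Q := by simp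
    rw [← this]
    refine Finset.card_le_card_of_injOn (fun w x => w (ε x).1 (ε x).2 + (ε x).1) ?_ ?_
    · intro w hw
      have hw' := Fintype.mem_piFinset.1 (Finset.mem_coe.1 hw)
      refine Finset.mem_coe.2 (mem_equidistributed.2 fun b => ?_)
      calc (Finset.univ.filter fun x => w (ε x).1 (ε x).2 + (ε x).1 = b).card
          = (Finset.univ.filter fun p : Q × Fin s => w p.1 p.2 + p.1 = b).card := by
            refine Finset.card_bij (fun x _ => ε x) (fun x hx => by simpa using hx)
              (fun _ _ _ _ h => ε.injective h) fun p hp => ⟨ε.symm p, by simpa using hp, by simp⟩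
        _ = ∑ i : Q, (Finset.univ.filter fun j => w i j = b - i).card := by
            simp only [Finset.card_filter, ← Finset.univ_product_univ, Finset.sum_product,
              eq_sub_iff_add_eq]
        _ = ∑ i : Q, (c (b - i) : ℕ) := Finset.sum_congr rfl fun i _ => hcount _ (hw' i) _
        _ = ∑ i : Q, (c i : ℕ) := (Equiv.subLeft b).sum_comp fun i => (c i : ℕ)
        _ = ∑ i : Q, (Finset.univ.filter fun j => w b j = i).card :=
            Finset.sum_congr rfl fun i _ => (hcount _ (hw' b) _).symm
        _ = s := by
            have := Finset.card_eq_sum_card_fiberwise (f := w b) (s := Finset.univ)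
              (t := Finset.univ) fun _ _ => Finset.mem_coe.2 (Finset.mem_univ _)
            rw [Finset.card_univ, Fintype.card_fin] at this
            convert this.symm
    · intro w _ w' _ h
      funext i j
      have := congrFun h (ε.symm (i, j))
      simpa using this
  calc (Fintype.card Q ^ s) ^ Fintype.card Q
      ≤ ((s + 1) ^ Fintype.card Q * C.card) ^ Fintype.card Q := Nat.pow_le_pow_left h1 _
    _ = ((s + 1) ^ Fintype.card Q) ^ Fintype.card Q * C.card ^ Fintype.card Q := mul_pow _ _ _
    _ ≤ _ := Nat.mul_le_mul_left _ h2

/-- Exponential lower bound for the number of equidistributed functions. -/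
lemma exists_exp_le_card_equidistributed {q : ℕ} (hq : 0 < q) {θ : ℝ} (hθ : θ < Real.log q) :
    ∃ s₀ : ℕ, ∀ s ≥ s₀, ∀ (E Q : Type) [Fintype E] [Fintype Q], Fintype.card Q = q →
      Fintype.card E = q * s →
      q * Real.exp (θ * (q * s : ℕ)) ≤ (equidistributed E Q s).card := by
  have hq' : (0 : ℝ) < q := by exact_mod_cast hq
  have hlim : Tendsto (fun s : ℕ => (q : ℝ) * (q * Real.log ((s : ℝ) + 1)) / s + Real.log q / s)
      atTop (𝓝 0) := by
    have h1 : Tendsto (fun s : ℕ => Real.log ((s : ℝ) + 1) / s) atTop (𝓝 0) := by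
      have h2 := (Real.isLittleO_log_id_atTop.tendsto_div_nhds_zero).comp
        (tendsto_atTop_add_const_right atTop (1 : ℝ) tendsto_natCast_atTop_atTop)
      have h3 : Tendsto (fun s : ℕ => 1 + 1 / (s : ℝ)) atTop (𝓝 1) := by
        simpa using (tendsto_one_div_atTop_nhds_zero_nat (𝕜 := ℝ)).const_add 1
      have h4 := h2.mul h3
      rw [zero_mul] at h4
      refine h4.congr' ?_
      filter_upwards [eventually_gt_atTop 0] with s hs
      have : (s : ℝ) ≠ 0 := by exact_mod_cast hs.ne'
      have : (s : ℝ) + 1 ≠ 0 := by positivity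
      simp only [Function.comp_apply, id]
      field_simp
    have h5 := (h1.const_mul ((q : ℝ) * q)).add
      (tendsto_natCast_atTop_atTop (R := ℝ) |>.const_div_atTop (Real.log q))
    simp only [mul_zero, add_zero] at h5
    refine h5.congr fun s => ?_
    ring
  have hpos : 0 < q * (Real.log q - θ) := mul_pos hq' (sub_pos.2 hθ)
  obtain ⟨s₀, hs₀⟩ := eventually_atTop.1 (hlim.eventually (gt_mem_nhds hpos))
  refine ⟨max s₀ 1, fun s hs E Q _ _ hQ hE => ?_⟩
  have hs1 : (0 : ℝ) < s := by
    have : 1 ≤ s := (le_max_right _ _).trans hs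
    exact_mod_cast this
  have : Nonempty Q := Fintype.card_pos_iff.1 (hQ ▸ hq)
  have h1 := pow_le_card_equidistributed (E := E) (Q := Q) (s := s) (by rw [hQ, hE])
  rw [hQ] at h1
  have h2 := hs₀ s ((le_max_left _ _).trans hs)
  rw [← add_div, div_lt_iff₀ hs1] at h2
  have h3 : ((q : ℝ) ^ s) ^ q ≤ (((s : ℝ) + 1) ^ q) ^ q * (equidistributed E Q s).card := by
    exact_mod_cast h1
  have hP : (0 : ℝ) < (((s : ℝ) + 1) ^ q) ^ q := by positivity
  refine le_of_mul_le_mul_left (le_trans ?_ h3) hP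
  have e1 : (q : ℝ) = Real.exp (Real.log q) := (Real.exp_log hq').symm
  have e2 : (s : ℝ) + 1 = Real.exp (Real.log ((s : ℝ) + 1)) := (Real.exp_log (by positivity)).symm
  calc (((s : ℝ) + 1) ^ q) ^ q * (q * Real.exp (θ * (q * s : ℕ)))
      = Real.exp (q * (q * Real.log ((s : ℝ) + 1)) + (Real.log q + θ * (q * s : ℕ))) := by
        rw [Real.exp_add, Real.exp_add, Real.exp_nat_mul, Real.exp_nat_mul, ← e2, ← e1]
    _ ≤ Real.exp (q * (s * Real.log q)) := by
        refine Real.exp_le_exp.2 ?_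
        push_cast
        nlinarith
    _ = ((q : ℝ) ^ s) ^ q := by rw [Real.exp_nat_mul, Real.exp_nat_mul, ← e1]

/-- Families of equidistributed functions of prescribed exponential size which take a common
value `a` at `e₀`, and for which `e₀` is the only point where all of them take the value `a`. -/
lemma exists_equidistributed_family {q : ℕ} (hq : 2 ≤ q) {η : ℝ} (hη : 0 < η)
    (hηq : η < Real.log q) :
    ∃ s₀ : ℕ, ∀ s ≥ s₀, ∀ (E Q : Type) [Fintype E] [Fintype Q], Fintype.card Q = q →
      Fintype.card E = q * s → ∀ e₀ : E, ∃ (a : Q) (U : Finset (E → Q)),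
        U ⊆ equidistributed E Q s ∧ (∀ f ∈ U, f e₀ = a) ∧ (∀ e ≠ e₀, ∃ f ∈ U, f e ≠ a) ∧
        U.card = ⌊Real.exp (η * (q * s : ℕ))⌋₊ + 1 := by
  obtain ⟨θ, hηθ, hθ⟩ := exists_between hηq
  have hq0 : 0 < q := by omega
  obtain ⟨s₁, hs₁⟩ := exists_exp_le_card_equidistributed hq0 hθ
  have hA : ∀ᶠ n : ℕ in atTop, (n : ℝ) ≤ Real.exp (η * n) := by
    have h := ((Real.tendsto_exp_div_pow_atTop 1).comp
      ((tendsto_natCast_atTop_atTop (R := ℝ)).const_mul_atTop hη)).eventually_ge_atTop η⁻¹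
    filter_upwards [h, eventually_gt_atTop 0] with n hn hn0
    have hn0' : (0 : ℝ) < n := by exact_mod_cast hn0
    simp only [Function.comp_apply, pow_one] at hn
    rw [le_div_iff₀ (by positivity), inv_mul_cancel_left₀ hη.ne'] at hn
    exact hn
  have hB : ∀ᶠ n : ℕ in atTop, Real.exp (η * n) + 1 ≤ Real.exp (θ * n) := by
    have h := ((tendsto_natCast_atTop_atTop (R := ℝ)).const_mul_atTop
      (sub_pos.2 hηθ)).eventually_ge_atTop 1
    filter_upwards [h] with n hn
    have h1 : (1 : ℝ) ≤ Real.exp (η * n) := Real.one_le_exp (by positivity)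
    have h2 := Real.add_one_le_exp ((θ - η) * n)
    have h3 : Real.exp (θ * n) = Real.exp (η * n) * Real.exp ((θ - η) * n) := by
      rw [← Real.exp_add]; ring_nf
    rw [h3]
    nlinarith
  obtain ⟨n₀, hn₀⟩ := eventually_atTop.1 (hA.and hB)
  refine ⟨max (max s₁ n₀) 1, fun s hs E Q _ _ hQ hE e₀ => ?_⟩
  have hs1 : s₁ ≤ s := ((le_max_left _ _).trans (le_max_left _ _)).trans hs
  have hspos : 1 ≤ s := (le_max_right _ _).trans hs
  have hn : n₀ ≤ q * s := ((le_max_right _ _).trans (le_max_left _ _)).trans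
    (hs.trans (Nat.le_mul_of_pos_left s hq0))
  obtain ⟨hA', hB'⟩ := hn₀ _ hn
  have : Nonempty Q := Fintype.card_pos_iff.1 (hQ ▸ hq0)
  obtain ⟨a, ha⟩ := exists_card_le_mul_card_fiber (equidistributed E Q s) fun f => f e₀
  set V := (equidistributed E Q s).filter fun f => f e₀ = a with hV
  have hVcard : Real.exp (θ * (q * s : ℕ)) ≤ V.card := by
    have h1 := hs₁ s hs1 E Q hQ hE
    rw [hQ] at ha
    have h2 : ((equidistributed E Q s).card : ℝ) ≤ q * V.card := by exact_mod_cast ha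
    exact le_of_mul_le_mul_left (h1.trans h2) (by exact_mod_cast hq0)
  have hVne : V.Nonempty := Finset.card_pos.1 (by exact_mod_cast (Real.exp_pos _).trans_le hVcard)
  -- Exchanging the values at two points gives members of `V` not equal to `a` at a given point.
  have hdist : ∀ e : E, ∃ f ∈ V, e ≠ e₀ → f e ≠ a := by
    intro e
    obtain ⟨f, hf⟩ := hVne
    by_cases hfe : e ≠ e₀ ∧ f e = a
    swap
    · exact ⟨f, hf, fun h h' => hfe ⟨h, h'⟩⟩
    obtain ⟨he, hfa⟩ := hfe
    obtain ⟨hfeq, hf0⟩ := Finset.mem_filter.1 hf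
    rw [mem_equidistributed] at hfeq
    have : Nontrivial Q := Fintype.one_lt_card_iff_nontrivial.1 (by omega)
    obtain ⟨b, hb⟩ := exists_ne a
    obtain ⟨e', he'⟩ := Finset.card_pos.1 (show 0 < (Finset.univ.filter fun e => f e = b).card by
      rw [hfeq]; omega)
    have he'b : f e' = b := (Finset.mem_filter.1 he').2
    have hne0 : e' ≠ e₀ := fun h => hb (by rw [← he'b, h, hf0])
    refine ⟨f ∘ Equiv.swap e e', Finset.mem_filter.2 ⟨mem_equidistributed.2 fun c => ?_, ?_⟩,
      fun _ => ?_⟩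
    · rw [← hfeq c]
      refine Finset.card_bij (fun x _ => Equiv.swap e e' x) (fun x hx => by simpa using hx)
        (fun _ _ _ _ h => (Equiv.swap e e').injective h)
        fun x hx => ⟨Equiv.swap e e' x, by simpa using hx, by simp⟩
    · rw [Function.comp_apply, Equiv.swap_apply_of_ne_of_ne he.symm hne0.symm, hf0]
    · rw [Function.comp_apply, Equiv.swap_apply_left, he'b]
      exact hb
  choose w hwV hw using hdist
  have hfloor : (⌊Real.exp (η * (q * s : ℕ))⌋₊ : ℝ) ≤ Real.exp (η * (q * s : ℕ)) :=
    Nat.floor_le (Real.exp_pos _).le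
  obtain ⟨U, hwU, hUV, hU⟩ := Finset.exists_subsuperset_card_eq
    (s := Finset.univ.image w) (t := V) (n := ⌊Real.exp (η * (q * s : ℕ))⌋₊ + 1)
    (Finset.image_subset_iff.2 fun e _ => hwV e)
    (Finset.card_image_le.trans (by
      rw [Finset.card_univ, hE]
      exact (Nat.le_floor hA').trans (Nat.le_succ _)))
    (by
      have : ((⌊Real.exp (η * (q * s : ℕ))⌋₊ + 1 : ℕ) : ℝ) ≤ V.card := by
        push_cast at hfloor hB' hVcard ⊢
        linarith
      exact_mod_cast this)
  refine ⟨a, U, fun f hf => (Finset.mem_filter.1 (hUV hf)).1,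
    fun f hf => (Finset.mem_filter.1 (hUV hf)).2, fun e he => ?_, hU⟩
  exact ⟨w e, hwU (Finset.mem_image_of_mem w (Finset.mem_univ e)), hw e he⟩

end Equidistributed

/-! ### Gluing blocks -/

namespace Tiling

open scoped Classical

variable {G A : Type*} [AddCommGroup G] (S S' : Tiling G)

/-- The positions of the tiles of `S` inside the tile of `S'` over `0`. -/
noncomputable def inner : Finset G := S'.D.filter fun e => e ∈ S.Γ

lemma mem_inner {e : G} : e ∈ S.inner S' ↔ S'.P e = 0 ∧ e ∈ S.Γ := by
  rw [inner, Finset.mem_filter, S'.mem_D]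

variable {S S'} (h : Coarser S S')
include h

lemma Coarser.P_sub_P_mem (g : G) : S.P g - S'.P g ∈ S.inner S' := by
  rw [mem_inner, sub_eq_add_neg, S'.P_add _ _ (neg_mem (S'.P_mem g)), h.P_P, add_neg_cancel]
  exact ⟨rfl, add_mem (S.P_mem g) (neg_mem (h.le (S'.P_mem g)))⟩

lemma Coarser.card_D : S'.D.card = (S.inner S').card * S.D.card := by
  rw [← Finset.card_product]
  refine Finset.card_bij' (fun g _ => (S.P g, g - S.P g)) (fun p _ => p.1 + p.2) ?_ ?_ ?_ ?_
  · intro g hg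
    rw [S'.mem_D] at hg
    refine Finset.mem_product.2 ⟨?_, S.sub_P_mem_D g⟩
    exact (mem_inner S S').2 ⟨by rw [h.P_P, hg], S.P_mem g⟩
  · rintro ⟨e, δ⟩ hp
    obtain ⟨he, hδ⟩ := Finset.mem_product.1 hp
    obtain ⟨he0, heΓ⟩ := (mem_inner S S').1 he
    rw [S.mem_D] at hδ
    rw [S'.mem_D, ← h.P_P, S.P_add_left _ heΓ, hδ, add_zero, he0]
  · intro g _
    exact add_sub_cancel _ _
  · rintro ⟨e, δ⟩ hp
    obtain ⟨he, hδ⟩ := Finset.mem_product.1 hp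
    obtain ⟨-, heΓ⟩ := (mem_inner S S').1 he
    rw [S.mem_D] at hδ
    dsimp only at hδ heΓ ⊢
    rw [S.P_add_left _ heΓ, hδ, add_zero, add_sub_cancel_left]

/-- The block on the tiles of `S'` obtained by placing the block `f e` of `B` on the tile of `S`
over `e`. -/
def glue {B : Finset (G → A)} (f : S.inner S' → B) (g : G) : A :=
  (f ⟨S.P g - S'.P g, h.P_sub_P_mem g⟩).1 g

variable {B : Finset (G → A)} (hper : ∀ b ∈ B, ∀ g, ∀ γ ∈ S.Γ, b (g + γ) = b g)

lemma glue_eq (f : S.inner S' → B) (e : S.inner S') {g : G} (hg : S.P g = e) :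
    glue h f g = (f e).1 g := by
  have he := ((mem_inner S S').1 e.2).1
  have : S.P g - S'.P g = e := by rw [← h.P_P, hg, he, sub_zero]
  have this' : (⟨_, h.P_sub_P_mem g⟩ : S.inner S') = e := Subtype.ext this
  rw [glue, this']

include hper

lemma glue_add (f : S.inner S' → B) (g : G) {γ : G} (hγ : γ ∈ S'.Γ) :
    glue h f (g + γ) = glue h f g := by
  have : S.P (g + γ) - S'.P (g + γ) = S.P g - S'.P g := by
    rw [S.P_add _ _ (h.le hγ), S'.P_add _ _ hγ, add_sub_add_right_eq_sub]
  unfold glue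
  simp only [this]
  exact hper _ (f _).2 _ _ (h.le hγ)

lemma glue_agrees_iff (f : S.inner S' → B) (e : S.inner S') (c : B) :
    (∀ g, S.P g = e → glue h f g = c.1 g) ↔ f e = c := by
  constructor
  · intro hg
    refine Subtype.ext (S.ext_of_periodic (hper _ (f e).2) (hper _ c.2)
      ((mem_inner S S').1 e.2).2 fun g he => ?_)
    rw [← glue_eq h f e he, hg g he]
  · rintro rfl g he
    exact glue_eq h f e he

lemma glue_injective : Function.Injective (glue h : (S.inner S' → B) → G → A) := by
  intro f f' hff
  funext e
  rw [← glue_agrees_iff h hper f e (f' e), hff, glue_agrees_iff h hper]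

lemma ncard_glue_agrees (f : S.inner S' → B) (c : B) :
    {e : G | e ∈ S'.D ∧ e ∈ S.Γ ∧ ∀ g, S.P g = e → glue h f g = c.1 g}.ncard =
      (Finset.univ.filter fun e => f e = c).card := by
  rw [← Finset.card_image_of_injective _ Subtype.val_injective, ← Set.ncard_coe_finset]
  congr 1
  ext e
  simp only [Finset.coe_image, Finset.coe_filter, Finset.mem_univ, true_and, Set.mem_image,
    Set.mem_ofPred_eq, S'.mem_D]
  constructor
  · rintro ⟨he, heΓ, hg⟩
    exact ⟨⟨e, (mem_inner S S').2 ⟨he, heΓ⟩⟩, (glue_agrees_iff h hper f _ c).1 hg, rfl⟩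
  · rintro ⟨e, he, rfl⟩
    have := (mem_inner S S').1 e.2
    exact ⟨this.1, this.2, (glue_agrees_iff h hper f e c).2 he⟩

end Tiling

/-! ### Cubes in the lattice -/

section Cube

variable {d : ℕ}

/-- The tiling of `ℤ ^ d` by the translates of the cube `[-A, N - A) ^ d` by the elements of
`N ℤ ^ d`. -/
noncomputable def cubeTiling (d : ℕ) {N A : ℕ} (hA : A < N) : Tiling (Fin d → ℤ) where
  Γ := AddSubgroup.pi Set.univ fun _ => AddSubgroup.zmultiples (N : ℤ)
  P g i := N * ((g i + A) / N)
  D := Fintype.piFinset fun _ => Finset.Ico (-A : ℤ) (N - A)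
  P_mem g i _ := Int.mem_zmultiples_iff.2 (dvd_mul_right _ _)
  P_add g γ hγ := by
    funext i
    obtain ⟨c, hc⟩ := Int.mem_zmultiples_iff.1 (hγ i (Set.mem_univ i))
    have hN : (N : ℤ) ≠ 0 := by omega
    have : g i + γ i + A = g i + A + N * c := by rw [hc]; ring
    simp only [Pi.add_apply]
    rw [this, Int.add_mul_ediv_left _ _ hN, hc]
    ring
  P_zero := by
    funext i
    simp only [Pi.zero_apply, zero_add]
    rw [Int.ediv_eq_zero_of_lt (by omega) (by omega), mul_zero]
  mem_D g := by
    have hN : (0 : ℤ) < N := by omega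
    simp only [Fintype.mem_piFinset, Finset.mem_Ico, funext_iff, Pi.zero_apply, mul_eq_zero,
      hN.ne', false_or]
    refine forall_congr' fun i => ⟨fun h => Int.ediv_eq_zero_of_lt (by omega) (by omega),
      fun h => ?_⟩
    have h1 := Int.emod_add_mul_ediv (g i + A) N
    have h2 := Int.emod_nonneg (g i + A) hN.ne'
    have h3 := Int.emod_lt_of_pos (g i + A) hN
    rw [h, mul_zero] at h1
    omega

lemma mem_cubeTiling_Γ {N A : ℕ} (hA : A < N) {g : Fin d → ℤ} :
    g ∈ (cubeTiling d hA).Γ ↔ ∀ i, (N : ℤ) ∣ g i := by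
  simp [cubeTiling, AddSubgroup.mem_pi, Int.mem_zmultiples_iff]

lemma mem_cubeTiling_D {N A : ℕ} (hA : A < N) {g : Fin d → ℤ} :
    g ∈ (cubeTiling d hA).D ↔ ∀ i, -(A : ℤ) ≤ g i ∧ g i < N - A := by
  simp [cubeTiling]

lemma card_cubeTiling_D {N A : ℕ} (hA : A < N) : (cubeTiling d hA).D.card = N ^ d := by
  simp [cubeTiling]

lemma coarser_cubeTiling {N A m : ℕ} (hA : A < N) (hA' : A + N < N * m) :
    Tiling.Coarser (cubeTiling d hA) (cubeTiling d hA') where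
  le g hg := by
    rw [mem_cubeTiling_Γ] at hg ⊢
    intro i
    exact (Dvd.intro _ (by push_cast; rfl)).trans (hg i)
  P_P g := by
    funext i
    have hN : (N : ℤ) ≠ 0 := by omega
    simp only [cubeTiling]
    push_cast
    congr 1
    rw [← Int.ediv_ediv_of_nonneg (by omega), ← Int.ediv_ediv_of_nonneg (by omega)]
    congr 1
    have e1 : (N : ℤ) * ((g i + A) / N) + (A + N) = A + N * ((g i + A) / N + 1) := by ring
    have e2 : g i + (A + N) = g i + A + N * 1 := by ring
    rw [e1, e2, Int.add_mul_ediv_left _ _ hN, Int.add_mul_ediv_left _ _ hN,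
      Int.ediv_eq_zero_of_lt (by omega) (by omega), zero_add]

/-- A large cube changes little under a translation. -/
lemma tendsto_cubeTiling {N A : ℕ → ℕ} (hA : ∀ n, A n < N n) (hN : Tendsto N atTop atTop)
    (g : Fin d → ℤ) :
    Tendsto (fun n => (({r | r ∈ (cubeTiling d (hA n)).D ∧ r + g ∉ (cubeTiling d (hA n)).D} :
      Set (Fin d → ℤ)).ncard : ℝ) / ((cubeTiling d (hA n)).D.card)) atTop (𝓝 0) := by
  have hN' : Tendsto (fun n => (N n : ℝ)) atTop atTop := tendsto_natCast_atTop_atTop.comp hN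
  have h1 : Tendsto (fun n => 1 - ∏ i : Fin d, ((((N n : ℤ) - 2 * |g i|).toNat : ℝ) / N n)) atTop
      (𝓝 0) := by
    have h2 : ∀ i : Fin d, Tendsto (fun n => (((N n : ℤ) - 2 * |g i|).toNat : ℝ) / N n) atTop
        (𝓝 1) := by
      intro i
      have h3 := (hN'.const_div_atTop (2 * |(g i : ℝ)|)).const_sub 1
      rw [sub_zero] at h3
      refine h3.congr' ?_
      filter_upwards [hN.eventually_gt_atTop (2 * |g i|).toNat] with n hn
      have e : ((((N n : ℤ) - 2 * |g i|).toNat : ℤ) : ℝ) = ((N n : ℤ) - 2 * |g i| : ℤ) := by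
        rw [Int.toNat_of_nonneg (by omega)]
      have hpos : (N n : ℝ) ≠ 0 := by
        have : 0 < N n := by omega
        exact_mod_cast this.ne'
      rw [Int.cast_natCast] at e
      rw [e]
      push_cast
      field_simp
    simpa using (tendsto_finsetProd Finset.univ fun i _ => h2 i).const_sub 1
  refine squeeze_zero (fun n => by positivity) (fun n => ?_) h1
  have hD : 0 < (cubeTiling d (hA n)).D.card := by
    rw [card_cubeTiling_D]; exact pow_pos (by have := hA n; omega) _
  rw [div_le_iff₀ (by exact_mod_cast hD), sub_mul, one_mul, le_sub_iff_add_le]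
  rw [Finset.prod_div_distrib, Finset.prod_const, Finset.card_univ, Fintype.card_fin]
  have hcast : ((cubeTiling d (hA n)).D.card : ℝ) = (N n : ℝ) ^ d := by
    rw [card_cubeTiling_D]; push_cast; rfl
  rw [hcast, div_mul_cancel₀ _ (by rw [← hcast]; exact_mod_cast hD.ne'), ← hcast]
  have hset : ({r | r ∈ (cubeTiling d (hA n)).D ∧ r + g ∉ (cubeTiling d (hA n)).D} :
      Set (Fin d → ℤ)) =
      ((cubeTiling d (hA n)).D.filter fun r => r + g ∉ (cubeTiling d (hA n)).D : Finset _) := by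
    ext; simp
  have hgood : ∏ i : Fin d, ((N n : ℤ) - 2 * |g i|).toNat ≤
      ((cubeTiling d (hA n)).D.filter fun r => r + g ∈ (cubeTiling d (hA n)).D).card := by
    have : (Fintype.piFinset fun i : Fin d =>
        Finset.Ico (-(A n : ℤ) + |g i|) (N n - A n - |g i|)).card =
        ∏ i : Fin d, ((N n : ℤ) - 2 * |g i|).toNat := by
      rw [Fintype.card_piFinset]
      refine Finset.prod_congr rfl fun i _ => ?_
      rw [Int.card_Ico]
      congr 1; ring
    rw [← this]
    refine Finset.card_le_card fun r hr => ?_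
    rw [Fintype.mem_piFinset] at hr
    rw [Finset.mem_filter, mem_cubeTiling_D, mem_cubeTiling_D]
    have key : ∀ i, -(A n : ℤ) ≤ r i ∧ r i < N n - A n ∧ -(A n : ℤ) ≤ r i + g i ∧
        r i + g i < N n - A n := by
      intro i
      have h1 := Finset.mem_Ico.1 (hr i)
      have h2 := neg_abs_le (g i)
      have h3 := le_abs_self (g i)
      omega
    exact ⟨fun i => ⟨(key i).1, (key i).2.1⟩, fun i => (key i).2.2⟩
  rw [hset, Set.ncard_coe_finset]
  have hsplit := Finset.card_filter_add_card_filter_not (s := (cubeTiling d (hA n)).D)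
    (fun r => r + g ∈ (cubeTiling d (hA n)).D)
  have : ((cubeTiling d (hA n)).D.filter fun r => r + g ∉ (cubeTiling d (hA n)).D).card +
      ∏ i : Fin d, ((N n : ℤ) - 2 * |g i|).toNat ≤ (cubeTiling d (hA n)).D.card := by omega
  exact_mod_cast this

end Cube

/-! ### The recursive construction -/

namespace Tiling

open scoped Classical

variable {G A : Type*} [AddCommGroup G]

lemma zero_mem_inner {S S' : Tiling G} : (0 : G) ∈ S.inner S' :=
  (mem_inner S S').2 ⟨S'.P_zero, zero_mem _⟩

lemma Coarser.blockStep {S S' : Tiling G} (h : Coarser S S') {B : Finset (G → A)}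
    (hper : ∀ b ∈ B, ∀ g, ∀ γ ∈ S.Γ, b (g + γ) = b g) {s : ℕ} (hs : 0 < s) {a : B}
    {U : Finset (S.inner S' → B)} (hU : U ⊆ equidistributed (S.inner S') B s)
    (hUa : ∀ f ∈ U, f ⟨0, zero_mem_inner⟩ = a)
    (hUd : ∀ e ≠ ⟨0, zero_mem_inner⟩, ∃ f ∈ U, f e ≠ a) :
    BlockStep S S' B (U.image (glue h)) a.1 s where
  a_mem := a.2
  t_pos := hs
  concat := by
    intro b hb u hu
    obtain ⟨f, -, rfl⟩ := Finset.mem_image.1 hb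
    have hw := S'.P_mem u
    refine ⟨_, (f ⟨S.P u - S'.P u, h.P_sub_P_mem u⟩).2, fun g hg => ?_⟩
    have e : S.P g - S'.P g = S.P u - S'.P u := by
      rw [hg, S.P_of_mem hu, ← h.P_P g, hg]
    simp only [glue, e]
  center := by
    intro b hb g hg
    obtain ⟨f, hf, rfl⟩ := Finset.mem_image.1 hb
    rw [glue_eq h f ⟨0, zero_mem_inner⟩ hg, hUa f hf]
  count := by
    intro b hb c hc
    obtain ⟨f, hf, rfl⟩ := Finset.mem_image.1 hb
    rw [ncard_glue_agrees h hper f ⟨c, hc⟩]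
    convert mem_equidistributed.1 (hU hf) ⟨c, hc⟩
  distinct := by
    intro e he hne
    have hw := S'.P_mem e
    have he1 : e - S'.P e ∈ S.inner S' := by
      have := h.P_sub_P_mem e
      rwa [S.P_of_mem he] at this
    obtain ⟨f, hf, hfa⟩ := hUd ⟨_, he1⟩ fun h0 => by
      have h1 : e - S'.P e = 0 := congrArg Subtype.val h0
      exact hne (by rw [sub_eq_zero.1 h1]; exact hw)
    refine ⟨glue h f, Finset.mem_image_of_mem _ hf, ?_⟩
    by_contra hcon
    push Not at hcon
    refine hfa ((glue_agrees_iff h hper f ⟨_, he1⟩ a).1 fun g hg => ?_)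
    dsimp only at hg
    have heΓ := ((mem_inner S S').1 he1).2
    have h1 : g - (e - S'.P e) ∈ S.D := by
      rw [← hg]; exact S.sub_P_mem_D g
    have h2 := hcon _ h1
    have h3 : e + (g - (e - S'.P e)) = g + S'.P e := by abel
    rwa [h3, glue_add h hper f g hw, sub_eq_add_neg, hper a.1 a.2 _ _ (neg_mem heΓ)] at h2

end Tiling

/-- A level of the construction: a cube tiling and more than `exp (h * N ^ d)` blocks on its
tiles. -/
structure Stage (d k : ℕ) (h : ℝ) where
  N : ℕ
  A : ℕ
  lt : A < N
  B : Finset ((Fin d → ℤ) → Fin k)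
  periodic : ∀ b ∈ B, ∀ g, ∀ γ ∈ (cubeTiling d lt).Γ, b (g + γ) = b g
  lt_log : h * (N ^ d : ℕ) < Real.log B.card

namespace Stage

variable {d k : ℕ} {h : ℝ}

/-- The tiling of a stage. -/
noncomputable def tiling (S : Stage d k h) : Tiling (Fin d → ℤ) := cubeTiling d S.lt

/-- `S'` can follow `S` as stage number `n + 1`. -/
structure IsNext (n : ℕ) (S S' : Stage d k h) (a : (Fin d → ℤ) → Fin k) (t : ℕ) : Prop where
  N_eq : ∃ m, 3 ≤ m ∧ n + 1 ∣ m ∧ S'.N = S.N * m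
  A_eq : S'.A = S.A + S.N
  log_le : Real.log S'.B.card ≤ h * (S'.N ^ d : ℕ) + Real.log 2
  blocks : Tiling.BlockStep S.tiling S'.tiling S.B S'.B a t

lemma IsNext.coarser {n : ℕ} {S S' : Stage d k h} {a : (Fin d → ℤ) → Fin k} {t : ℕ}
    (H : IsNext n S S' a t) : Tiling.Coarser S.tiling S'.tiling := by
  obtain ⟨m, -, -, hm⟩ := H.N_eq
  have hA := H.A_eq
  obtain ⟨N', A', hlt, B', per, big⟩ := S'
  dsimp only at hm hA
  subst hm hA
  exact coarser_cubeTiling S.lt hlt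

lemma exists_next (hd : 1 ≤ d) (h_pos : 0 < h) (n : ℕ) (S : Stage d k h) :
    ∃ S' a t, IsNext n S S' a t := by
  classical
  have hN : 0 < S.N := by have := S.lt; omega
  have hη : 0 < h * (S.N ^ d : ℕ) := mul_pos h_pos (by exact_mod_cast pow_pos hN d)
  set q := S.B.card with hq
  have hq2 : 2 ≤ q := by
    by_contra hlt
    have : (q : ℝ) ≤ 1 := by exact_mod_cast (by omega : q ≤ 1)
    have := Real.log_nonpos (Nat.cast_nonneg q) this
    have := S.lt_log
    linarith
  obtain ⟨s₀, hs₀⟩ := exists_equidistributed_family hq2 hη S.lt_log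
  obtain ⟨m, hm⟩ : ∃ m, m = 3 * (n + 1) * q * (s₀ + 1) := ⟨_, rfl⟩
  have hm3 : 3 ≤ m := by
    have : 1 ≤ (n + 1) * q * (s₀ + 1) := Nat.one_le_iff_ne_zero.2 (by positivity)
    calc 3 = 3 * 1 := rfl
      _ ≤ 3 * ((n + 1) * q * (s₀ + 1)) := Nat.mul_le_mul_left _ this
      _ = m := by rw [hm]; ring
  have hqm : q ∣ m := ⟨3 * (n + 1) * (s₀ + 1), by rw [hm]; ring⟩
  obtain ⟨s, hs⟩ : q ∣ m ^ d := hqm.trans (dvd_pow_self m (by omega))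
  have hss : s₀ + 1 ≤ s := by
    have h1 : q * (s₀ + 1) ≤ q * s := by
      rw [← hs]
      refine le_trans ?_ (Nat.le_self_pow (by omega) m)
      calc q * (s₀ + 1) = 1 * (q * (s₀ + 1)) := (one_mul _).symm
        _ ≤ (3 * (n + 1)) * (q * (s₀ + 1)) := Nat.mul_le_mul_right _ (by omega)
        _ = m := by rw [hm]; ring
    exact Nat.le_of_mul_le_mul_left h1 (by omega)
  have hlt : S.A + S.N < S.N * m := by
    have h1 := S.lt
    have h2 : S.N * 3 ≤ S.N * m := Nat.mul_le_mul_left _ hm3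
    omega
  have hco : Tiling.Coarser S.tiling (cubeTiling d hlt) := coarser_cubeTiling S.lt hlt
  have hinner : Fintype.card (S.tiling.inner (cubeTiling d hlt)) = q * s := by
    have h1 := hco.card_D
    rw [card_cubeTiling_D, show S.tiling.D.card = S.N ^ d from card_cubeTiling_D S.lt,
      mul_pow, mul_comm] at h1
    rw [Fintype.card_coe, ← Nat.eq_of_mul_eq_mul_right (pow_pos hN d) h1, hs]
  obtain ⟨a, U, hU, hUa, hUd, hUcard⟩ := hs₀ s (by omega) (S.tiling.inner (cubeTiling d hlt)) S.B
    (by simp [hq]) hinner ⟨0, Tiling.zero_mem_inner⟩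
  have hstep := hco.blockStep S.periodic (by omega) hU hUa hUd
  have hexp : h * (S.N ^ d : ℕ) * (q * s : ℕ) = h * ((S.N * m) ^ d : ℕ) := by
    rw [← hs]; push_cast; ring
  have hcard : (U.image (Tiling.glue hco)).card =
      ⌊Real.exp (h * ((S.N * m) ^ d : ℕ))⌋₊ + 1 := by
    rw [Finset.card_image_of_injective _ (Tiling.glue_injective hco S.periodic), hUcard, hexp]
  have hlow : Real.exp (h * ((S.N * m) ^ d : ℕ)) < (U.image (Tiling.glue hco)).card := by
    rw [hcard]; exact_mod_cast Nat.lt_floor_add_one _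
  have hpos : (0 : ℝ) < (U.image (Tiling.glue hco)).card := (Real.exp_pos _).trans hlow
  refine ⟨⟨S.N * m, S.A + S.N, hlt, U.image (Tiling.glue hco), ?_, ?_⟩, a.1, s,
    ⟨m, hm3, ⟨3 * q * (s₀ + 1), by rw [hm]; ring⟩, rfl⟩, rfl, ?_, hstep⟩
  · intro b hb g γ hγ
    obtain ⟨f, -, rfl⟩ := Finset.mem_image.1 hb
    exact Tiling.glue_add hco S.periodic f g hγ
  · exact (Real.lt_log_iff_exp_lt hpos).2 hlow
  · have h1 : (1 : ℝ) ≤ Real.exp (h * ((S.N * m) ^ d : ℕ)) := Real.one_le_exp (by positivity)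
    have h2 : ((U.image (Tiling.glue hco)).card : ℝ) ≤ 2 * Real.exp (h * ((S.N * m) ^ d : ℕ)) := by
      have h3 := Nat.floor_le (Real.exp_pos (h * ((S.N * m) ^ d : ℕ))).le
      rw [hcard, Nat.cast_add, Nat.cast_one]
      linarith
    refine (Real.log_le_log hpos h2).trans ?_
    rw [Real.log_mul two_ne_zero (Real.exp_pos _).ne', Real.log_exp, add_comm]

/-- The stage whose tiles are points and whose blocks are the symbols. -/
noncomputable def initial (hlt : h < Real.log k) : Stage d k h where
  N := 1
  A := 0
  lt := Nat.one_pos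
  B := Finset.univ.map ⟨fun c _ => c, fun _ _ hc => congrFun hc 0⟩
  periodic := by
    intro b hb g γ _
    obtain ⟨c, -, rfl⟩ := Finset.mem_map.1 hb
    rfl
  lt_log := by simpa using hlt

end Stage

/-- A block scheme on `ℤ ^ d` with prescribed entropy whose subgroups are cofinal among the finite
index subgroups. -/
lemma exists_blockScheme {d k : ℕ} (hd : 1 ≤ d) {h : ℝ} (h_pos : 0 < h) (h_lt : h < Real.log k) :
    ∃ T : BlockScheme (Fin d → ℤ) (Fin k),
      (∀ n, h * (T.D n).card ≤ Real.log (T.B n).card) ∧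
      Tendsto (fun n => Real.log (T.B n).card / (T.D n).card) atTop (𝓝 h) ∧
      ∀ Δ : AddSubgroup (Fin d → ℤ), Δ.FiniteIndex → ∃ n, T.Γ n ≤ Δ := by
  choose next a t hnext using fun n => Stage.exists_next (k := k) hd h_pos n
  let σ : ℕ → Stage d k h := fun n => Nat.rec (Stage.initial h_lt) next n
  have hσ : ∀ n, Stage.IsNext n (σ n) (σ (n + 1)) (a n (σ n)) (t n (σ n)) := fun n => hnext n (σ n)
  have hA : ∀ n, n ≤ (σ n).A := by
    intro n
    induction n with
    | zero => exact Nat.zero_le _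
    | succ n ih =>
      rw [(hσ n).A_eq]
      have := (σ n).lt
      omega
  have hAN : ∀ n, (σ n).A + n ≤ (σ n).N := by
    intro n
    cases n with
    | zero => exact Nat.zero_le 1
    | succ n =>
      obtain ⟨m, hm3, -, hm⟩ := (hσ n).N_eq
      rw [(hσ n).A_eq, hm]
      have h1 := (σ n).lt
      have h2 : (σ n).N * 3 ≤ (σ n).N * m := Nat.mul_le_mul_left _ hm3
      have h3 := hA n
      omega
  have hNtop : Tendsto (fun n => (σ n).N) atTop atTop :=
    tendsto_atTop_mono (fun n => (Nat.le_add_left n _).trans (hAN n)) tendsto_id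
  have hcardD : ∀ n, (σ n).tiling.D.card = (σ n).N ^ d := fun n => card_cubeTiling_D (σ n).lt
  let T : BlockScheme (Fin d → ℤ) (Fin k) :=
    { tiling := fun n => (σ n).tiling
      Γ_zero := by
        refine eq_top_iff.2 fun g _ => (mem_cubeTiling_Γ _).2 fun i => ?_
        exact one_dvd (g i)
      coarser := fun n => (hσ n).coarser
      exhaust := by
        intro g
        obtain ⟨n, hn⟩ : ∃ n : ℕ, ∀ i, |g i| < n := by
          refine ⟨(∑ i, |g i|).toNat + 1, fun i => ?_⟩
          have h1 := Finset.single_le_sum (f := fun i => |g i|) (fun i _ => abs_nonneg (g i))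
            (Finset.mem_univ i)
          have h2 := Int.self_le_toNat (∑ i, |g i|)
          push_cast
          omega
        refine ⟨n, ((σ n).tiling.mem_D g).1 ((mem_cubeTiling_D _).2 fun i => ?_)⟩
        have h1 := hn i
        have h2 := hA n
        have h3 := hAN n
        rw [abs_lt] at h1
        omega
      foelner := tendsto_cubeTiling (fun n => (σ n).lt) hNtop
      B := fun n => (σ n).B
      a := fun n => a n (σ n)
      t := fun n => t n (σ n)
      periodic := fun n => (σ n).periodic
      step := fun n => (hσ n).blocks }
  refine ⟨T, fun n => ?_, ?_, fun Δ hΔ => ?_⟩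
  · change h * ((σ n).tiling.D.card : ℝ) ≤ Real.log (σ n).B.card
    rw [hcardD]
    exact (σ n).lt_log.le
  · change Tendsto (fun n => Real.log (σ n).B.card / ((σ n).tiling.D.card : ℝ)) atTop (𝓝 h)
    simp only [hcardD]
    have hpow : Tendsto (fun n => (((σ n).N ^ d : ℕ) : ℝ)) atTop atTop :=
      tendsto_natCast_atTop_atTop.comp ((tendsto_pow_atTop (by omega)).comp hNtop)
    have hup := (hpow.const_div_atTop (Real.log 2)).const_add h
    rw [add_zero] at hup
    have hpos : ∀ n, (0 : ℝ) < ((σ n).N ^ d : ℕ) := fun n => by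
      have := (σ n).lt
      exact_mod_cast pow_pos (by omega : 0 < (σ n).N) d
    refine tendsto_of_tendsto_of_tendsto_of_le_of_le' tendsto_const_nhds hup
      (.of_forall fun n => ?_) ?_
    · rw [le_div_iff₀ (hpos n)]
      exact (σ n).lt_log.le
    · filter_upwards [eventually_gt_atTop 0] with n hn
      obtain ⟨n, rfl⟩ := Nat.exists_eq_add_one_of_ne_zero hn.ne'
      rw [div_le_iff₀ (hpos (n + 1)), add_mul, div_mul_cancel₀ _ (hpos (n + 1)).ne']
      exact (hσ n).log_le
  · obtain ⟨j, hj⟩ := Nat.exists_eq_succ_of_ne_zero hΔ.index_ne_zero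
    refine ⟨j + 1, fun γ hγ => ?_⟩
    obtain ⟨m, -, hjm, hm⟩ := (hσ j).N_eq
    have hdvd : (Δ.index : ℤ) ∣ ((σ (j + 1)).N : ℤ) := by
      rw [hm, hj]
      exact_mod_cast hjm.trans (dvd_mul_left _ _)
    choose c hc using fun i => hdvd.trans ((mem_cubeTiling_Γ (σ (j + 1)).lt).1 hγ i)
    have : γ = Δ.index • c := by
      funext i
      rw [hc i]
      simp
    rw [this]
    exact Δ.nsmul_index_mem c

theorem theoremA (d : ℕ) (hd : 1 ≤ d) (k : ℕ) (hk : 2 ≤ k) (h : ℝ) (h_pos : 0 < h)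
    (h_lt : h < Real.log k) :
    ∃ x : (Fin d → ℤ) → Fin k,
      IsToeplitz x ∧
      IsStrictlyErgodic (Fin d → ℤ) (orbitClosure x).carrier ∧
      HasTopologicalEntropy (orbitClosure x) h ∧
      ∃ S : OdometerSequence (Fin d → ℤ), IsUniversalOdometer S ∧
        IsMaximalEquicontinuousFactor (Fin d → ℤ) (orbitClosure x).carrier (Odometer S) := by
  obtain ⟨T, hlow, hlim, hcof⟩ := exists_blockScheme hd h_pos h_lt
  have : Nonempty (Fin d) := ⟨⟨0, hd⟩⟩
  exact ⟨T.point, T.isToeplitz_point, T.isStrictlyErgodic, T.hasTopologicalEntropy hlow hlim,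
    T.odometerSequence, Odometer.isUniversalOdometer_of_cofinal hcof,
    T.isMaximalEquicontinuousFactor⟩
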